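/- **First incompleteness theorem (computer scientist's form).** Let $L$ be a first-order language with equality, with finitely many function and relation symbols, containing the symbols $0$, $S$, $+$, $\times$ of arithmetic. Fix a numbering of the symbols of $L$, extended to terms, formulas and sentences of $L$ by the usual coding of finite trees as natural numbers; a set of sentences is called decidable if the set of the numbers of its elements is computable. Let $T$ be a theory in $L$ (a set of sentences, its axioms; provability is derivability from them in classical first-order logic with equality) such that 1. the set of axioms of $T$ is decidable; 2. $T$ is an extension of Robinson's arithmetic, i.e. $T$ proves the axioms $\forall x\forall y\,(S(x)=S(y)\Rightarrow x=y)$, $\forall x\,\neg(0=S(x))$, $\forall x\,(x=0\vee\exists y\;x=S(y))$, $\forall x\;x+0=x$, $\forall x\forall y\;x+S(y)=S(x+y)$, $\forall x\;x\times 0=0$, $\forall x\forall y\;x\times S(y)=(x\times y)+x$; 3. $T$ has a standard model, i.e. a model with domain $\mathbb N$ in which $0,S,+,\times$ have their usual interpretation (and the other symbols of $L$, if any, an arbitrary one). Then provability in $T$ is undecidable, i.e. the set of sentences provable in $T$ is not decidable; and $T$ is incomplete, i.e. there is a sentence $A$ of $L$ such that neither $A$ nor $\neg A$ is provable in $T$.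 -/

import Mathlib

open FirstOrder FirstOrder.Language

universe u v

namespace Incompleteness

/-! ### The language of arithmetic, Robinson's arithmetic, the standard model -/

/-- The function symbols `0`, `S`, `+`, `×` of arithmetic, indexed by their arity. -/
inductive ArithFunc : ℕ → Type
  | zero : ArithFunc 0
  | succ : ArithFunc 1
  | add : ArithFunc 2
  | mul : ArithFunc 2

/-- The language of arithmetic. Equality is the logical equality of first-order logic. -/
abbrev arith : FirstOrder.Language.{0, 0} where
  Functions := ArithFunc
  Relations := fun _ => Empty

/-- The standard interpretation of the language of arithmetic in the natural numbers. -/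
instance standardStructure : arith.Structure ℕ where
  funMap {n} (f : ArithFunc n) :=
    match n, f with
    | _, .zero => fun _ => 0
    | _, .succ => fun v => v 0 + 1
    | _, .add => fun v => v 0 + v 1
    | _, .mul => fun v => v 0 * v 1
  RelMap {_} (r : Empty) := r.elim

/-- Terms of arithmetic whose variables are the bound variables `0, …, n - 1`. -/
abbrev ATerm (n : ℕ) := arith.Term (Empty ⊕ Fin n)

abbrev zeroT {n : ℕ} : ATerm n := Term.func ArithFunc.zero ![]
abbrev succT {n : ℕ} (t : ATerm n) : ATerm n := Term.func ArithFunc.succ ![t]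
abbrev addT {n : ℕ} (t u : ATerm n) : ATerm n := Term.func ArithFunc.add ![t, u]
abbrev mulT {n : ℕ} (t u : ATerm n) : ATerm n := Term.func ArithFunc.mul ![t, u]
abbrev varT {n : ℕ} (i : Fin n) : ATerm n := Term.var (Sum.inr i)

/-- `∀ x y, S x = S y → x = y` -/
def succInj : arith.Sentence :=
  BoundedFormula.all <| BoundedFormula.all <|
    ((succT (varT 0) : ATerm 2).bdEqual (succT (varT 1))).imp ((varT 0 : ATerm 2).bdEqual (varT 1))

/-- `∀ x, ¬ (0 = S x)` -/
def zeroNeSucc : arith.Sentence :=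
  BoundedFormula.all <| ((zeroT : ATerm 1).bdEqual (succT (varT 0))).not

/-- `∀ x, x = 0 ∨ ∃ y, x = S y` -/
def zeroOrSucc : arith.Sentence :=
  BoundedFormula.all <|
    ((varT 0 : ATerm 1).bdEqual zeroT) ⊔
      BoundedFormula.ex ((varT 0 : ATerm 2).bdEqual (succT (varT 1)))

/-- `∀ x, x + 0 = x` -/
def addZero : arith.Sentence :=
  BoundedFormula.all <| (addT (varT 0) zeroT : ATerm 1).bdEqual (varT 0)

/-- `∀ x y, x + S y = S (x + y)` -/
def addSucc : arith.Sentence :=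
  BoundedFormula.all <| BoundedFormula.all <|
    (addT (varT 0) (succT (varT 1)) : ATerm 2).bdEqual (succT (addT (varT 0) (varT 1)))

/-- `∀ x, x × 0 = 0` -/
def mulZero : arith.Sentence :=
  BoundedFormula.all <| (mulT (varT 0) zeroT : ATerm 1).bdEqual zeroT

/-- `∀ x y, x × S y = x × y + x` -/
def mulSucc : arith.Sentence :=
  BoundedFormula.all <| BoundedFormula.all <|
    (mulT (varT 0) (succT (varT 1)) : ATerm 2).bdEqual (addT (mulT (varT 0) (varT 1)) (varT 0))

/-- Robinson's arithmetic. -/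
def robinson : arith.Theory :=
  {succInj, zeroNeSucc, zeroOrSucc, addZero, addSucc, mulZero, mulSucc}

/-! ### Substitution and provability

A formula in context `n`, that is an element of `L.BoundedFormula Empty n`, has its free variables
among `0, …, n - 1`; the quantifier `all` binds the variable `n` of a formula in context `n + 1`. -/

section Provability

variable {L : FirstOrder.Language.{u, v}}

/-- Extends a substitution under a quantifier, leaving the newly bound variable fixed. -/
def liftSubst {m n : ℕ} (σ : Fin m → L.Term (Empty ⊕ Fin n)) :
    Fin (m + 1) → L.Term (Empty ⊕ Fin (n + 1)) :=
  Fin.snoc (fun i => (σ i).relabel (Sum.map id Fin.castSucc)) (Term.var (Sum.inr (Fin.last n)))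

/-- Simultaneous substitution of terms for the variables of a term. -/
def substTerm {m n : ℕ} (σ : Fin m → L.Term (Empty ⊕ Fin n)) (t : L.Term (Empty ⊕ Fin m)) :
    L.Term (Empty ⊕ Fin n) :=
  t.subst (Sum.elim Empty.elim σ)

/-- Simultaneous (capture-free) substitution of terms for the free variables of a formula. -/
def substFormula : ∀ {m n : ℕ}, (Fin m → L.Term (Empty ⊕ Fin n)) →
    L.BoundedFormula Empty m → L.BoundedFormula Empty n
  | _, _, _, .falsum => .falsum
  | _, _, σ, .equal t u => .equal (substTerm σ t) (substTerm σ u)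
  | _, _, σ, .rel R ts => .rel R fun i => substTerm σ (ts i)
  | _, _, σ, .imp φ ψ => .imp (substFormula σ φ) (substFormula σ ψ)
  | _, _, σ, .all φ => .all (substFormula (liftSubst σ) φ)

/-- `inst φ t` is `φ` with the term `t` substituted for the last variable. -/
def inst {n : ℕ} (φ : L.BoundedFormula Empty (n + 1)) (t : L.Term (Empty ⊕ Fin n)) :
    L.BoundedFormula Empty n :=
  substFormula (Fin.snoc (fun i => Term.var (Sum.inr i)) t) φ

/-- A formula regarded as a formula with one more (unused) free variable. -/
def weaken {n : ℕ} (φ : L.BoundedFormula Empty n) : L.BoundedFormula Empty (n + 1) :=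
  substFormula (fun i => Term.var (Sum.inr i.castSucc)) φ

/-- A sentence regarded as a formula in context `n`. -/
def sentenceIn (n : ℕ) (φ : L.Sentence) : L.BoundedFormula Empty n :=
  substFormula (m := 0) (fun i => i.elim0) φ

/-- Classical first-order natural deduction with equality: `Derives T Γ φ` says that `φ` is
derivable from the axioms in `T` and the finitely many hypotheses `Γ`. The connectives other than
`⊥`, `→`, `∀` are abbreviations. The calculus is meant for languages with a constant symbol. -/
inductive Derives (T : L.Theory) :
    ∀ {n : ℕ}, List (L.BoundedFormula Empty n) → L.BoundedFormula Empty n → Prop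
  | ax {n : ℕ} {Γ : List (L.BoundedFormula Empty n)} {φ : L.Sentence} :
      φ ∈ T → Derives T Γ (sentenceIn n φ)
  | hyp {n : ℕ} {Γ : List (L.BoundedFormula Empty n)} {φ : L.BoundedFormula Empty n} :
      φ ∈ Γ → Derives T Γ φ
  | impI {n : ℕ} {Γ : List (L.BoundedFormula Empty n)} {φ ψ : L.BoundedFormula Empty n} :
      Derives T (φ :: Γ) ψ → Derives T Γ (φ.imp ψ)
  | impE {n : ℕ} {Γ : List (L.BoundedFormula Empty n)} {φ ψ : L.BoundedFormula Empty n} :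
      Derives T Γ (φ.imp ψ) → Derives T Γ φ → Derives T Γ ψ
  | raa {n : ℕ} {Γ : List (L.BoundedFormula Empty n)} {φ : L.BoundedFormula Empty n} :
      Derives T (φ.not :: Γ) .falsum → Derives T Γ φ
  | allI {n : ℕ} {Γ : List (L.BoundedFormula Empty n)} {φ : L.BoundedFormula Empty (n + 1)} :
      Derives T (Γ.map weaken) φ → Derives T Γ φ.all
  | allE {n : ℕ} {Γ : List (L.BoundedFormula Empty n)} {φ : L.BoundedFormula Empty (n + 1)}
      (t : L.Term (Empty ⊕ Fin n)) : Derives T Γ φ.all → Derives T Γ (inst φ t)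
  | eqRefl {n : ℕ} {Γ : List (L.BoundedFormula Empty n)} (t : L.Term (Empty ⊕ Fin n)) :
      Derives T Γ (.equal t t)
  | eqSubst {n : ℕ} {Γ : List (L.BoundedFormula Empty n)} (φ : L.BoundedFormula Empty (n + 1))
      {t u : L.Term (Empty ⊕ Fin n)} :
      Derives T Γ (.equal t u) → Derives T Γ (inst φ t) → Derives T Γ (inst φ u)

/-- The sentence `φ` is provable in the theory `T`. -/
def Provable (T : L.Theory) (φ : L.Sentence) : Prop :=
  Derives T (n := 0) [] φ

/-- `T`, in a language containing the one of arithmetic, is an extension of Robinson's arithmetic: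
it proves all its axioms. -/
def ExtendsRobinson (ι : arith →ᴸ L) (T : L.Theory) : Prop :=
  ∀ φ ∈ robinson, Provable T (ι.onSentence φ)

/-- `T` has a standard model: a model with domain `ℕ` in which the symbols of arithmetic have
their standard interpretation. -/
def HasStandardModel (ι : arith →ᴸ L) (T : L.Theory) : Prop :=
  ∃ _ : L.Structure ℕ, ι.IsExpansionOn ℕ ∧ ℕ ⊨ T

/-- `T` is complete: it proves or refutes every sentence. -/
def Complete (T : L.Theory) : Prop :=
  ∀ φ : L.Sentence, Provable T φ ∨ Provable T φ.not

/-! ### Numbering of syntax and decidability -/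

/-- The number of a finite tree, given the numbers of its root label `f` and of its immediate
subtrees `t₁, …, tₚ`: it is `f ; (t₁ ; (… ; (tₚ ; 0)))` with `a ; b = Nat.pair a b + 1`. -/
def treeCode (label : ℕ) (children : List ℕ) : ℕ :=
  Encodable.encode (label :: children)

/-- The number of a term, given a numbering of the symbols of the language. -/
def termCode (num : L.Symbols → ℕ) {n : ℕ} : L.Term (Empty ⊕ Fin n) → ℕ
  | .var (.inr i) => treeCode 0 [i.val]
  | .func f ts => treeCode (num (.inl ⟨_, f⟩) + 1) (List.ofFn fun i => termCode num (ts i))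

/-- The number of a formula, given a numbering of the symbols of the language. -/
def formulaCode (num : L.Symbols → ℕ) : ∀ {n : ℕ}, L.BoundedFormula Empty n → ℕ
  | _, .falsum => treeCode 0 []
  | _, .equal t u => treeCode 1 [termCode num t, termCode num u]
  | _, .imp φ ψ => treeCode 2 [formulaCode num φ, formulaCode num ψ]
  | _, .all φ => treeCode 3 [formulaCode num φ]
  | _, .rel R ts =>
      treeCode (num (.inr ⟨_, R⟩) + 4) (List.ofFn fun i => termCode num (ts i))

/-- A set of sentences is decidable when the set of the numbers of its elements is computable. -/
def DecidableSentences (num : L.Symbols → ℕ) (A : Set L.Sentence) : Prop :=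
  ComputablePred fun k : ℕ => ∃ φ : L.Sentence, φ ∈ A ∧ formulaCode num φ = k

end Provability

end Incompleteness

namespace Incompleteness

/-! ### Substitution -/

section Substitution

variable {L : FirstOrder.Language.{u, v}}

/-! The halting problem reduces to provability, with no self-referential sentence. Let K be the set
of programs that halt on input 0. There is a formula φ such that, for every k, a sentence A_k
expressing φ(k) is provable in T exactly when k ∈ K (`exists_provable_evalSentence_iff`).
Provability of A_k gives k ∈ K by soundness in the standard model (`Derives.sound`); conversely,
Robinson's arithmetic already proves every true numerical instance of φ. As the code of A_k is
computable from k, a decision procedure for provability would decide K.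

For incompleteness, the provable sentences are recursively enumerable once the axioms are
(`rePred_provable`). If T were complete, k ∉ K would be equivalent to T ⊢ ¬A_k, because a theory
with a model cannot prove both A_k and ¬A_k. Then K and its complement would both be recursively
enumerable, and K would be decidable by Post's theorem.

Representability (`isRepresentable_graph`) is needed only in a one-sided form: φ is correct in ℕ,
and its true instances are derivable. This notion is stable under ∧, ∨, ∃ and bounded ∀, which
suffices for an induction over the clauses defining partial recursive functions, with Gödel's β
function coding the history of a recursion. The main argument inside T is the one for bounded
quantifiers, `ExtendsRobinson.of_add_succ_eq_numeral`.

For enumerability, syntax, substitution and derivation become finitely many rules on codes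
(`judgmentRules`), sound and complete for the calculus. Each rule is enumerable, and so is the
closure under finitely many such rules (`RuleClosure.rePred`). -/

/-- The variables of a context, as terms. -/
abbrev idSubst (n : ℕ) : Fin n → L.Term (Empty ⊕ Fin n) := fun i => Term.var (Sum.inr i)

/-- The inclusion of a context into the one with one more variable. -/
abbrev wkSubst (n : ℕ) : Fin n → L.Term (Empty ⊕ Fin (n + 1)) :=
  fun i => Term.var (Sum.inr i.castSucc)

@[simp]
theorem substTerm_var {m n : ℕ} (σ : Fin m → L.Term (Empty ⊕ Fin n)) (i : Fin m) :
    substTerm σ (Term.var (Sum.inr i)) = σ i := rfl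

@[simp]
theorem substTerm_func {m n k : ℕ} (σ : Fin m → L.Term (Empty ⊕ Fin n)) (f : L.Functions k)
    (ts : Fin k → L.Term (Empty ⊕ Fin m)) :
    substTerm σ (Term.func f ts) = Term.func f fun i => substTerm σ (ts i) := rfl

theorem substTerm_idSubst {n : ℕ} (t : L.Term (Empty ⊕ Fin n)) : substTerm (idSubst n) t = t := by
  induction t with
  | var i =>
    rcases i with i | i
    · exact i.elim
    · rfl
  | func f ts ih => simp [ih]

theorem substTerm_substTerm {k m n : ℕ} (σ : Fin m → L.Term (Empty ⊕ Fin n))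
    (τ : Fin k → L.Term (Empty ⊕ Fin m)) (t : L.Term (Empty ⊕ Fin k)) :
    substTerm σ (substTerm τ t) = substTerm (fun i => substTerm σ (τ i)) t := by
  induction t with
  | var i =>
    rcases i with i | i
    · exact i.elim
    · rfl
  | func f ts ih => simp [ih]

theorem relabel_castSucc {n : ℕ} (t : L.Term (Empty ⊕ Fin n)) :
    t.relabel (Sum.map id Fin.castSucc) = substTerm (wkSubst n) t := by
  induction t with
  | var i =>
    rcases i with i | i
    · exact i.elim
    · rfl
  | func f ts ih => simp [Term.relabel, ih]

@[simp]
theorem liftSubst_castSucc {m n : ℕ} (σ : Fin m → L.Term (Empty ⊕ Fin n)) (i : Fin m) :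
    liftSubst σ i.castSucc = substTerm (wkSubst n) (σ i) := by
  simp [liftSubst, relabel_castSucc]

@[simp]
theorem liftSubst_last {m n : ℕ} (σ : Fin m → L.Term (Empty ⊕ Fin n)) :
    liftSubst σ (Fin.last m) = Term.var (Sum.inr (Fin.last n)) := by
  simp [liftSubst]

theorem liftSubst_idSubst (n : ℕ) : liftSubst (idSubst n : Fin n → L.Term _) = idSubst (n + 1) := by
  funext i
  induction i using Fin.lastCases <;> simp

theorem substTerm_liftSubst {k m n : ℕ} (σ : Fin m → L.Term (Empty ⊕ Fin n))
    (τ : Fin k → L.Term (Empty ⊕ Fin m)) :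
    (fun i => substTerm (liftSubst σ) (liftSubst τ i)) =
      liftSubst fun i => substTerm σ (τ i) := by
  funext i
  induction i using Fin.lastCases <;> simp [substTerm_substTerm]

theorem substFormula_idSubst {n : ℕ} (φ : L.BoundedFormula Empty n) :
    substFormula (idSubst n) φ = φ := by
  induction φ with
  | falsum => rfl
  | equal t u => simp [substFormula, substTerm_idSubst]
  | rel R ts => simp [substFormula, substTerm_idSubst]
  | imp φ ψ h₁ h₂ => simp [substFormula, h₁, h₂]
  | all φ h => simp [substFormula, liftSubst_idSubst, h]

theorem substFormula_substFormula {k m n : ℕ} (σ : Fin m → L.Term (Empty ⊕ Fin n))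
    (τ : Fin k → L.Term (Empty ⊕ Fin m)) (φ : L.BoundedFormula Empty k) :
    substFormula σ (substFormula τ φ) = substFormula (fun i => substTerm σ (τ i)) φ := by
  induction φ generalizing m n with
  | falsum => rfl
  | equal t u => simp [substFormula, substTerm_substTerm]
  | rel R ts => simp [substFormula, substTerm_substTerm]
  | imp φ ψ h₁ h₂ => simp [substFormula, h₁, h₂]
  | all φ h => simp [substFormula, h, substTerm_liftSubst]

theorem substTerm_snoc_wkSubst {m n : ℕ} (σ : Fin m → L.Term (Empty ⊕ Fin n))
    (t : L.Term (Empty ⊕ Fin n)) (s : L.Term (Empty ⊕ Fin m)) :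
    substTerm (Fin.snoc σ t : Fin (m + 1) → L.Term (Empty ⊕ Fin n)) (substTerm (wkSubst m) s) =
      substTerm σ s := by
  simp [substTerm_substTerm]

/-- Lifting and then instantiating only extends the tuple of substituted terms, so nested universal
axioms can be instantiated one quantifier at a time. -/
theorem inst_substFormula_liftSubst {m n : ℕ} (σ : Fin m → L.Term (Empty ⊕ Fin n))
    (φ : L.BoundedFormula Empty (m + 1)) (t : L.Term (Empty ⊕ Fin n)) :
    inst (substFormula (liftSubst σ) φ) t =
      substFormula (Fin.snoc σ t : Fin (m + 1) → L.Term (Empty ⊕ Fin n)) φ := by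
  rw [inst, substFormula_substFormula]
  congr 1
  funext i
  induction i using Fin.lastCases
  · simp
  · simp [substTerm_snoc_wkSubst, substTerm_idSubst]

theorem substFormula_inst {m n : ℕ} (σ : Fin m → L.Term (Empty ⊕ Fin n))
    (φ : L.BoundedFormula Empty (m + 1)) (t : L.Term (Empty ⊕ Fin m)) :
    substFormula σ (inst φ t) = inst (substFormula (liftSubst σ) φ) (substTerm σ t) := by
  rw [inst_substFormula_liftSubst, inst, substFormula_substFormula]
  congr 1
  funext i
  induction i using Fin.lastCases <;> simp

theorem substFormula_liftSubst_weaken {m n : ℕ} (σ : Fin m → L.Term (Empty ⊕ Fin n))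
    (φ : L.BoundedFormula Empty m) :
    substFormula (liftSubst σ) (weaken φ) = weaken (substFormula σ φ) := by
  simp [weaken, substFormula_substFormula]

theorem substFormula_sentenceIn {m n : ℕ} (σ : Fin m → L.Term (Empty ⊕ Fin n)) (φ : L.Sentence) :
    substFormula σ (sentenceIn m φ) = sentenceIn n φ := by
  rw [sentenceIn, substFormula_substFormula]
  congr 1
  exact Subsingleton.elim _ _

end Substitution

/-! ### Structural rules and soundness -/

section Structural

variable {L : FirstOrder.Language.{u, v}} {T : L.Theory}

theorem Derives.mono {n : ℕ} {Γ Δ : List (L.BoundedFormula Empty n)} {φ : L.BoundedFormula Empty n}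
    (h : Derives T Γ φ) (hΓ : Γ ⊆ Δ) : Derives T Δ φ := by
  induction h with
  | ax h => exact .ax h
  | hyp h => exact .hyp (hΓ h)
  | impI _ ih => exact .impI (ih (List.cons_subset_cons _ hΓ))
  | impE _ _ ih₁ ih₂ => exact .impE (ih₁ hΓ) (ih₂ hΓ)
  | raa _ ih => exact .raa (ih (List.cons_subset_cons _ hΓ))
  | allI _ ih => exact .allI (ih (List.map_subset _ hΓ))
  | allE t _ ih => exact .allE t (ih hΓ)
  | eqRefl t => exact .eqRefl t
  | eqSubst φ _ _ ih₁ ih₂ => exact .eqSubst φ (ih₁ hΓ) (ih₂ hΓ)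

theorem Derives.substFormula {m n : ℕ} {Γ : List (L.BoundedFormula Empty m)}
    {φ : L.BoundedFormula Empty m} (h : Derives T Γ φ) (σ : Fin m → L.Term (Empty ⊕ Fin n)) :
    Derives T (Γ.map (substFormula σ)) (substFormula σ φ) := by
  induction h generalizing n with
  | ax h => rw [substFormula_sentenceIn]; exact .ax h
  | hyp h => exact .hyp (List.mem_map_of_mem h)
  | impI _ ih => exact .impI (ih σ)
  | impE _ _ ih₁ ih₂ => exact .impE (ih₁ σ) (ih₂ σ)
  | raa _ ih => exact .raa (ih σ)
  | allI _ ih =>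
    refine .allI ?_
    have := ih (liftSubst σ)
    rw [List.map_map] at this ⊢
    simpa only [Function.comp_def, substFormula_liftSubst_weaken] using this
  | allE t _ ih => rw [substFormula_inst]; exact .allE _ (ih σ)
  | eqRefl t => exact .eqRefl _
  | eqSubst φ _ _ ih₁ ih₂ =>
    have h₂ := ih₂ σ
    rw [substFormula_inst] at h₂ ⊢
    exact .eqSubst _ (ih₁ σ) h₂

/-- Substituting along the empty map moves a closed derivation into any context; hypotheses are then
added by monotonicity. -/
theorem Provable.derives {φ : L.Sentence} (h : Provable T φ) {n : ℕ}
    (Γ : List (L.BoundedFormula Empty n)) : Derives T Γ (sentenceIn n φ) :=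
  (Derives.substFormula h fun i => i.elim0).mono (by simp)

theorem realize_substTerm {M : Type*} [L.Structure M] {m n : ℕ}
    (σ : Fin m → L.Term (Empty ⊕ Fin n)) (t : L.Term (Empty ⊕ Fin m)) (v : Empty → M)
    (x : Fin n → M) :
    (substTerm σ t).realize (Sum.elim v x) =
      t.realize (Sum.elim v fun i => (σ i).realize (Sum.elim v x)) := by
  induction t with
  | var i =>
    rcases i with i | i
    · exact i.elim
    · rfl
  | func f ts ih => simp [ih]

theorem realize_substFormula {M : Type*} [L.Structure M] {m n : ℕ}
    (σ : Fin m → L.Term (Empty ⊕ Fin n)) (φ : L.BoundedFormula Empty m) (v : Empty → M)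
    (x : Fin n → M) :
    (substFormula σ φ).Realize v x ↔
      φ.Realize v fun i => (σ i).realize (Sum.elim v x) := by
  induction φ generalizing n with
  | falsum => rfl
  | equal t u => simp [substFormula, BoundedFormula.Realize, realize_substTerm]
  | rel R ts => simp [substFormula, BoundedFormula.Realize, realize_substTerm]
  | imp φ ψ h₁ h₂ => simp [substFormula, h₁, h₂]
  | all φ h =>
    simp only [substFormula, BoundedFormula.realize_all, h]
    refine forall_congr' fun a => iff_of_eq ?_
    congr 1
    funext i
    induction i using Fin.lastCases <;> simp [realize_substTerm]

theorem realize_inst {M : Type*} [L.Structure M] {n : ℕ} (φ : L.BoundedFormula Empty (n + 1))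
    (t : L.Term (Empty ⊕ Fin n)) (v : Empty → M) (x : Fin n → M) :
    (inst φ t).Realize v x ↔
      φ.Realize v (Fin.snoc x (t.realize (Sum.elim v x)) : Fin (n + 1) → M) := by
  rw [inst, realize_substFormula]
  refine iff_of_eq ?_
  congr 1
  funext i
  induction i using Fin.lastCases <;> simp

theorem Derives.sound {M : Type*} [L.Structure M] (hM : M ⊨ T) {n : ℕ}
    {Γ : List (L.BoundedFormula Empty n)} {φ : L.BoundedFormula Empty n} (h : Derives T Γ φ)
    (v : Empty → M) (x : Fin n → M) (hΓ : ∀ γ ∈ Γ, γ.Realize v x) : φ.Realize v x := by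
  induction h with
  | ax h =>
    rw [sentenceIn, realize_substFormula]
    have := hM.realize_of_mem _ h
    rw [Sentence.Realize, Formula.Realize] at this
    convert this
  | hyp h => exact hΓ _ h
  | impI _ ih => exact fun h => ih x (by simpa using ⟨h, hΓ⟩)
  | impE _ _ ih₁ ih₂ => exact ih₁ x hΓ (ih₂ x hΓ)
  | raa _ ih =>
    by_contra hφ
    exact ih x (by simpa using ⟨hφ, hΓ⟩)
  | allI _ ih =>
    intro a
    refine ih _ fun γ hγ => ?_
    obtain ⟨δ, hδ, rfl⟩ := List.mem_map.1 hγ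
    simpa [weaken, realize_substFormula] using hΓ δ hδ
  | allE t _ ih => exact (realize_inst _ _ _ _).2 (ih x hΓ _)
  | eqRefl t => rfl
  | eqSubst φ _ _ ih₁ ih₂ =>
    have h₁ := ih₁ x hΓ
    have h₂ := ih₂ x hΓ
    rw [realize_inst] at h₂ ⊢
    rw [BoundedFormula.Realize] at h₁
    rwa [← h₁]

end Structural

/-! ### Derived rules -/

section DerivedRules

variable {L : FirstOrder.Language.{u, v}} {T : L.Theory} {n : ℕ}
  {Γ : List (L.BoundedFormula Empty n)} {φ ψ χ : L.BoundedFormula Empty n}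

theorem Derives.cons (h : Derives T Γ φ) : Derives T (χ :: Γ) φ :=
  h.mono (List.subset_cons_self _ _)

theorem Derives.head : Derives T (φ :: Γ) φ := .hyp List.mem_cons_self

theorem Derives.weaken (h : Derives T Γ φ) : Derives T (Γ.map weaken) (weaken φ) :=
  Derives.substFormula h _

theorem Derives.exFalso (h : Derives T Γ .falsum) : Derives T Γ φ := .raa h.cons

theorem Derives.andI (h₁ : Derives T Γ φ) (h₂ : Derives T Γ ψ) : Derives T Γ (φ ⊓ ψ) :=
  .impI (.impE (.impE .head h₁.cons) h₂.cons)

theorem Derives.orI_left (h : Derives T Γ φ) : Derives T Γ (φ ⊔ ψ) :=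
  .impI (.exFalso (.impE .head h.cons))

theorem Derives.orI_right (h : Derives T Γ ψ) : Derives T Γ (φ ⊔ ψ) := .impI h.cons

/-- Disjunction unfolds to ¬φ → ψ, so the argument is by contradiction: ¬χ refutes φ, hence ψ holds
and yields χ. -/
theorem Derives.orE (h : Derives T Γ (φ ⊔ ψ)) (h₁ : Derives T (φ :: Γ) χ)
    (h₂ : Derives T (ψ :: Γ) χ) : Derives T Γ χ := by
  refine .raa ?_
  have hφ : Derives T (χ.not :: Γ) φ.not := .impI (.impE (Derives.cons .head)
    (h₁.mono (List.cons_subset_cons _ (List.subset_cons_self _ _))))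
  have hψ : Derives T (χ.not :: Γ) ψ := .impE h.cons hφ
  exact .impE .head (.impE (.cons (.impI h₂)) hψ)

theorem Derives.exI {φ : L.BoundedFormula Empty (n + 1)} (t : L.Term (Empty ⊕ Fin n))
    (h : Derives T Γ (inst φ t)) : Derives T Γ φ.ex :=
  .impI (.impE (Derives.allE (φ := φ.not) t .head) h.cons)

theorem Derives.exE {φ : L.BoundedFormula Empty (n + 1)} (h : Derives T Γ φ.ex)
    (h' : Derives T (φ :: Γ.map Incompleteness.weaken) (Incompleteness.weaken ψ)) :
    Derives T Γ ψ := by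
  refine .raa (.impE h.cons (.allI (.impI ?_)))
  refine .impE (φ := Incompleteness.weaken ψ) ?_ (h'.mono ?_)
  · exact .hyp (List.mem_cons_of_mem _ List.mem_cons_self)
  · exact List.cons_subset_cons _ (List.subset_cons_self _ _)

theorem Derives.allE_substFormula {k : ℕ} {σ : Fin k → L.Term (Empty ⊕ Fin n)}
    {φ : L.BoundedFormula Empty (k + 1)} (h : Derives T Γ (Incompleteness.substFormula σ φ.all))
    (t : L.Term (Empty ⊕ Fin n)) :
    Derives T Γ (Incompleteness.substFormula
      (Fin.snoc σ t : Fin (k + 1) → L.Term (Empty ⊕ Fin n)) φ) := by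
  rw [← inst_substFormula_liftSubst]
  exact .allE t h

theorem Derives.eqSubst_substFormula {k : ℕ} {σ : Fin k → L.Term (Empty ⊕ Fin n)}
    {t u : L.Term (Empty ⊕ Fin n)} (φ : L.BoundedFormula Empty (k + 1))
    (h : Derives T Γ (.equal t u))
    (h' : Derives T Γ (Incompleteness.substFormula
      (Fin.snoc σ t : Fin (k + 1) → L.Term (Empty ⊕ Fin n)) φ)) :
    Derives T Γ (Incompleteness.substFormula
      (Fin.snoc σ u : Fin (k + 1) → L.Term (Empty ⊕ Fin n)) φ) := by
  rw [← inst_substFormula_liftSubst] at h' ⊢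
  exact .eqSubst _ h h'

/-- The primitive rule rewrites the last variable only. Putting a fresh last variable in place i, as
`τ` does, reduces a rewrite in any coordinate to it. -/
theorem Derives.eqSubst_update {k : ℕ} (φ : L.BoundedFormula Empty k)
    (σ : Fin k → L.Term (Empty ⊕ Fin n)) (i : Fin k) {u : L.Term (Empty ⊕ Fin n)}
    (h : Derives T Γ (.equal (σ i) u)) (h' : Derives T Γ (Incompleteness.substFormula σ φ)) :
    Derives T Γ (Incompleteness.substFormula (Function.update σ i u) φ) := by
  let τ : Fin k → L.Term (Empty ⊕ Fin (n + 1)) :=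
    Function.update (fun j => substTerm (wkSubst n) (σ j)) i (.var (.inr (Fin.last n)))
  have key (s : L.Term (Empty ⊕ Fin n)) : inst (Incompleteness.substFormula τ φ) s =
      Incompleteness.substFormula (Function.update σ i s) φ := by
    rw [inst, substFormula_substFormula]
    congr 1
    funext j
    by_cases hj : j = i
    · subst hj; simp [τ]
    · simp [τ, hj, substTerm_snoc_wkSubst, substTerm_idSubst]
  rw [← key]
  refine .eqSubst _ h ?_
  rwa [key, Function.update_eq_self]

theorem Derives.eqSubst_forall {k : ℕ} (φ : L.BoundedFormula Empty k)
    {σ τ : Fin k → L.Term (Empty ⊕ Fin n)} (h : ∀ i, Derives T Γ (.equal (σ i) (τ i)))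
    (h' : Derives T Γ (Incompleteness.substFormula σ φ)) :
    Derives T Γ (Incompleteness.substFormula τ φ) := by
  -- Coordinates are rewritten one at a time: the hybrid substitution is τ below m and still σ from
  -- m on.
  have key : ∀ m ≤ k, Derives T Γ
      (Incompleteness.substFormula (fun i : Fin k => if i.val < m then τ i else σ i) φ) := by
    intro m
    induction m with
    | zero => simpa using h'
    | succ m ih =>
      intro hm
      have := Derives.eqSubst_update φ _ ⟨m, hm⟩ (u := τ ⟨m, hm⟩) (by simpa using h ⟨m, hm⟩)
        (ih (by lia))
      convert this using 2
      funext i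
      rcases lt_trichotomy i.val m with hi | hi | hi
      · have : i ≠ ⟨m, hm⟩ := fun h => by simp [h] at hi
        simp [this, hi, hi.trans (Nat.lt_succ_self m)]
      · obtain rfl : i = ⟨m, hm⟩ := Fin.ext hi
        simp
      · have h' : i ≠ ⟨m, hm⟩ := fun h => by simp [h] at hi
        have : ¬ i.val < m + 1 := by lia
        simp [this, h', hi.le.not_gt]
  simpa using key k le_rfl

theorem Derives.eqSymm {t u : L.Term (Empty ⊕ Fin n)} (h : Derives T Γ (.equal t u)) :
    Derives T Γ (.equal u t) := by
  -- In the pattern x₁ = x₀, the variable x₀ stays `t` while x₁ moves from `t` to `u`.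
  have := Derives.eqSubst_substFormula (σ := ![t]) (.equal (.var (.inr 1)) (.var (.inr 0))) h
    (.eqRefl t)
  exact this

theorem Derives.eqTrans {t u s : L.Term (Empty ⊕ Fin n)} (h : Derives T Γ (.equal t u))
    (h' : Derives T Γ (.equal u s)) : Derives T Γ (.equal t s) := by
  have := Derives.eqSubst_substFormula (σ := ![t]) (.equal (.var (.inr 0)) (.var (.inr 1))) h' h
  exact this

/-- Congruence comes from rewriting in f(x) = f(y) with 2k separate variables: start from `ts` in
both halves, by reflexivity, and change only the second half. -/
theorem Derives.eqFunc {k : ℕ} (f : L.Functions k) {ts us : Fin k → L.Term (Empty ⊕ Fin n)}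
    (h : ∀ i, Derives T Γ (.equal (ts i) (us i))) :
    Derives T Γ (.equal (.func f ts) (.func f us)) := by
  have := Derives.eqSubst_forall (T := T) (Γ := Γ) (σ := Fin.append ts ts) (τ := Fin.append ts us)
    (.equal (.func f fun i => .var (.inr (Fin.castAdd k i)))
      (.func f fun i => .var (.inr (Fin.natAdd k i))))
  simp only [Incompleteness.substFormula, substTerm_func, substTerm_var, Fin.append_left,
    Fin.append_right] at this
  refine this (fun i => ?_) (.eqRefl _)
  induction i using Fin.addCases
  · simpa using .eqRefl _
  · simpa only [Fin.append_right] using h _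

end DerivedRules

/-! ### Arithmetic in an extension of Robinson's arithmetic -/

section Arithmetic

variable {L : FirstOrder.Language.{u, v}} (ι : arith →ᴸ L) {n : ℕ}

/-- The term `0`. -/
def zeroL : L.Term (Empty ⊕ Fin n) := .func (ι.onFunction ArithFunc.zero) ![]
/-- The term `S t`. -/
def succL (t : L.Term (Empty ⊕ Fin n)) : L.Term (Empty ⊕ Fin n) :=
  .func (ι.onFunction ArithFunc.succ) ![t]
/-- The term `t + u`. -/
def addL (t u : L.Term (Empty ⊕ Fin n)) : L.Term (Empty ⊕ Fin n) :=
  .func (ι.onFunction ArithFunc.add) ![t, u]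
/-- The term `t × u`. -/
def mulL (t u : L.Term (Empty ⊕ Fin n)) : L.Term (Empty ⊕ Fin n) :=
  .func (ι.onFunction ArithFunc.mul) ![t, u]

/-- The numeral of a natural number. -/
def numeral : ℕ → L.Term (Empty ⊕ Fin n)
  | 0 => zeroL ι
  | k + 1 => succL ι (numeral k)

section

variable {m : ℕ} (σ : Fin m → L.Term (Empty ⊕ Fin n)) (t u : L.Term (Empty ⊕ Fin m))

@[simp]
theorem substTerm_zeroL : substTerm σ (zeroL ι) = zeroL ι := by
  simp only [zeroL, substTerm_func]
  congr 1
  exact Subsingleton.elim _ _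

@[simp]
theorem substTerm_succL : substTerm σ (succL ι t) = succL ι (substTerm σ t) := by
  simp only [succL, substTerm_func]
  congr 1
  funext i
  fin_cases i; rfl

@[simp]
theorem substTerm_addL :
    substTerm σ (addL ι t u) = addL ι (substTerm σ t) (substTerm σ u) := by
  simp only [addL, substTerm_func]
  congr 1
  funext i
  fin_cases i <;> rfl

@[simp]
theorem substTerm_mulL :
    substTerm σ (mulL ι t u) = mulL ι (substTerm σ t) (substTerm σ u) := by
  simp only [mulL, substTerm_func]
  congr 1
  funext i
  fin_cases i <;> rfl

@[simp]
theorem substTerm_numeral (k : ℕ) : substTerm σ (numeral ι k) = numeral ι k := by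
  induction k with
  | zero => simp [numeral]
  | succ k ih => simp [numeral, ih]

end

section

variable (t u : ATerm n)

theorem onTerm_zeroT : ι.onTerm (zeroT : ATerm n) = zeroL ι := by
  simp only [zeroL, LHom.onTerm]
  congr 1
  exact Subsingleton.elim _ _

theorem onTerm_succT : ι.onTerm (succT t) = succL ι (ι.onTerm t) := by
  simp only [succL, LHom.onTerm]
  congr 1
  funext i
  fin_cases i; rfl

theorem onTerm_addT : ι.onTerm (addT t u) = addL ι (ι.onTerm t) (ι.onTerm u) := by
  simp only [addL, LHom.onTerm]
  congr 1
  funext i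
  fin_cases i <;> rfl

theorem onTerm_mulT : ι.onTerm (mulT t u) = mulL ι (ι.onTerm t) (ι.onTerm u) := by
  simp only [mulL, LHom.onTerm]
  congr 1
  funext i
  fin_cases i <;> rfl

end

variable {ι} {T : L.Theory} {Γ : List (L.BoundedFormula Empty n)}
  {t t' u u' : L.Term (Empty ⊕ Fin n)} {ψ : L.BoundedFormula Empty n}

theorem Derives.succ_congr (h : Derives T Γ (.equal t u)) :
    Derives T Γ (.equal (succL ι t) (succL ι u)) :=
  .eqFunc _ fun i => by fin_cases i; exact h

theorem Derives.add_congr (h : Derives T Γ (.equal t t')) (h' : Derives T Γ (.equal u u')) :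
    Derives T Γ (.equal (addL ι t u) (addL ι t' u')) :=
  .eqFunc _ fun i => by fin_cases i; exacts [h, h']

theorem Derives.mul_congr (h : Derives T Γ (.equal t t')) (h' : Derives T Γ (.equal u u')) :
    Derives T Γ (.equal (mulL ι t u) (mulL ι t' u')) :=
  .eqFunc _ fun i => by fin_cases i; exacts [h, h']

namespace ExtendsRobinson

variable (hT : ExtendsRobinson ι T)
include hT

theorem succ_inj (h : Derives T Γ (.equal (succL ι t) (succL ι u))) :
    Derives T Γ (.equal t u) := by
  have := (((hT succInj (by simp [robinson])).derives Γ).allE_substFormula t).allE_substFormula u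
  simp only [substFormula, LHom.onBoundedFormula, onTerm_succT, substTerm_succL, Term.bdEqual]
    at this
  exact .impE this h

theorem zero_ne_succ (h : Derives T Γ (.equal (zeroL ι) (succL ι t))) : Derives T Γ ψ := by
  have := ((hT zeroNeSucc (by simp [robinson])).derives Γ).allE_substFormula t
  simp only [substFormula, LHom.onBoundedFormula, onTerm_succT, substTerm_succL, Term.bdEqual,
    onTerm_zeroT, substTerm_zeroL] at this
  exact .exFalso (.impE this h)

theorem zero_or_succ (t : L.Term (Empty ⊕ Fin n)) :
    Derives T Γ (.equal t (zeroL ι) ⊔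
      BoundedFormula.ex (.equal (substTerm (wkSubst n) t)
        (succL ι (.var (.inr (Fin.last n)))))) := by
  have := ((hT zeroOrSucc (by simp [robinson])).derives Γ).allE_substFormula t
  let σ : Fin 1 → L.Term (Empty ⊕ Fin n) := Fin.snoc (fun i => i.elim0) t
  have h₀ : substTerm (liftSubst σ) (ι.onTerm (varT 0)) = substTerm (wkSubst n) t :=
    liftSubst_castSucc σ 0
  have h₁ : substTerm (liftSubst σ) (ι.onTerm (varT 1)) = .var (.inr (Fin.last n)) :=
    liftSubst_last σ
  simp only [LHom.onBoundedFormula, onTerm_succT, Term.bdEqual, onTerm_zeroT, Max.max,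
    BoundedFormula.ex, BoundedFormula.not, Bot.bot, substFormula, substTerm_succL,
    substTerm_zeroL] at this ⊢
  rwa [h₀, h₁] at this

theorem add_zero (t : L.Term (Empty ⊕ Fin n)) :
    Derives T Γ (.equal (addL ι t (zeroL ι)) t) := by
  have := ((hT addZero (by simp [robinson])).derives Γ).allE_substFormula t
  simp only [substFormula, LHom.onBoundedFormula, onTerm_addT, substTerm_addL, Term.bdEqual,
    onTerm_zeroT, substTerm_zeroL] at this
  exact this

theorem add_succ (t u : L.Term (Empty ⊕ Fin n)) :
    Derives T Γ (.equal (addL ι t (succL ι u)) (succL ι (addL ι t u))) := by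
  have := (((hT addSucc (by simp [robinson])).derives Γ).allE_substFormula t).allE_substFormula u
  simp only [substFormula, LHom.onBoundedFormula, onTerm_addT, substTerm_addL, Term.bdEqual,
    onTerm_succT, substTerm_succL] at this
  exact this

theorem mul_zero (t : L.Term (Empty ⊕ Fin n)) :
    Derives T Γ (.equal (mulL ι t (zeroL ι)) (zeroL ι)) := by
  have := ((hT mulZero (by simp [robinson])).derives Γ).allE_substFormula t
  simp only [substFormula, LHom.onBoundedFormula, onTerm_mulT, substTerm_mulL, Term.bdEqual,
    onTerm_zeroT, substTerm_zeroL] at this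
  exact this

theorem mul_succ (t u : L.Term (Empty ⊕ Fin n)) :
    Derives T Γ (.equal (mulL ι t (succL ι u)) (addL ι (mulL ι t u) t)) := by
  have := (((hT mulSucc (by simp [robinson])).derives Γ).allE_substFormula t).allE_substFormula u
  simp only [substFormula, LHom.onBoundedFormula, onTerm_mulT, substTerm_mulL, onTerm_addT,
    substTerm_addL, Term.bdEqual, onTerm_succT, substTerm_succL] at this
  exact this

theorem add_numeral (a b : ℕ) :
    Derives T Γ (.equal (addL ι (numeral ι a) (numeral ι b)) (numeral ι (a + b))) := by
  induction b with
  | zero => exact hT.add_zero _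
  | succ b ih => exact .eqTrans (hT.add_succ _ _) (.succ_congr ih)

theorem mul_numeral (a b : ℕ) :
    Derives T Γ (.equal (mulL ι (numeral ι a) (numeral ι b)) (numeral ι (a * b))) := by
  induction b with
  | zero => exact hT.mul_zero _
  | succ b ih =>
    exact .eqTrans (hT.mul_succ _ _) (.eqTrans (.add_congr ih (.eqRefl _)) (hT.add_numeral _ _))

/-- Case analysis below a numeral, with external induction on N because T has no induction.
Cancelling a successor leaves u + t = N - 1; then t is 0, or S x with x subject to the same
hypothesis for N - 1. The term S t is the second summand because Robinson's axioms recurse there.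
The context is generalized since each step opens a new variable. -/
theorem of_add_succ_eq_numeral (N : ℕ)
    (h : Derives T Γ (.equal (addL ι u (succL ι t)) (numeral ι N)))
    (h' : ∀ i < N, Derives T Γ (BoundedFormula.imp (.equal t (numeral ι i)) ψ)) :
    Derives T Γ ψ := by
  induction N generalizing n with
  | zero => exact hT.zero_ne_succ (.eqTrans (.eqSymm h) (hT.add_succ _ _))
  | succ N ih =>
    have h₁ : Derives T Γ (.equal (addL ι u t) (numeral ι N)) :=
      hT.succ_inj (.eqTrans (.eqSymm (hT.add_succ _ _)) h)
    refine .orE (hT.zero_or_succ t) (.impE (.cons (h' 0 (Nat.succ_pos _))) .head)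
      (.exE .head ?_)
    have h₂ := Derives.weaken h₁
    refine ih (u := substTerm (wkSubst n) u) (t := .var (.inr (Fin.last n))) ?_ fun i hi => ?_
    · refine .eqTrans (.add_congr (.eqRefl _) (.eqSymm .head)) (.cons (.cons ?_))
      simpa [weaken, substFormula] using h₂
    -- The case x = i for the predecessor x is the case i + 1 for `t`.
    · have h₃ := Derives.weaken (h' (i + 1) (by lia))
      simp only [weaken, substFormula, substTerm_numeral] at h₃
      refine .impI (.impE (.cons (.cons (.cons h₃))) ?_)
      exact .eqTrans (.cons .head) (.succ_congr .head)

end ExtendsRobinson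

end Arithmetic

/-! ### Representable relations -/

section Representable

variable {L : FirstOrder.Language.{u, v}} (ι : arith →ᴸ L) (T : L.Theory) [L.Structure ℕ]

/-- A function is given by a term whose values the theory `T` computes. -/
def IsTermFun {k : ℕ} (f : (Fin k → ℕ) → ℕ) : Prop :=
  ∃ t : L.Term (Empty ⊕ Fin k), (∀ v, t.realize (Sum.elim Empty.elim v) = f v) ∧
    ∀ v, ∀ {n : ℕ} (Γ : List (L.BoundedFormula Empty n)),
      Derives T Γ (.equal (substTerm (fun i => numeral ι (v i)) t) (numeral ι (f v)))

/-- A relation is given by a formula that is correct in the standard model, and whose true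
numerical instances are derivable in the theory `T`. -/
def IsRepresentable {k : ℕ} (R : (Fin k → ℕ) → Prop) : Prop :=
  ∃ φ : L.BoundedFormula Empty k, (∀ v, φ.Realize Empty.elim v → R v) ∧
    ∀ v, R v → ∀ {n : ℕ} (Γ : List (L.BoundedFormula Empty n)),
      Derives T Γ (substFormula (fun i => numeral ι (v i)) φ)

section Realize

variable [ι.IsExpansionOn ℕ] {n : ℕ} (t u : L.Term (Empty ⊕ Fin n)) (w : Empty ⊕ Fin n → ℕ)

@[simp]
theorem realize_zeroL : (zeroL ι).realize w = 0 := by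
  rw [zeroL, Term.realize_func, LHom.map_onFunction]
  rfl

@[simp]
theorem realize_succL : (succL ι t).realize w = t.realize w + 1 := by
  rw [succL, Term.realize_func, LHom.map_onFunction]
  rfl

@[simp]
theorem realize_addL : (addL ι t u).realize w = t.realize w + u.realize w := by
  rw [addL, Term.realize_func, LHom.map_onFunction]
  rfl

@[simp]
theorem realize_mulL : (mulL ι t u).realize w = t.realize w * u.realize w := by
  rw [mulL, Term.realize_func, LHom.map_onFunction]
  rfl

@[simp]
theorem realize_numeral (k : ℕ) : (numeral ι k).realize w = k := by
  induction k with
  | zero => simp [numeral]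
  | succ k ih => simp [numeral, ih]

end Realize

variable {ι T} {k : ℕ} {f g : (Fin k → ℕ) → ℕ}

theorem IsTermFun.proj (i : Fin k) : IsTermFun ι T fun v => v i :=
  ⟨.var (.inr i), fun _ => rfl, fun _ _ _ => .eqRefl _⟩

omit [L.Structure ℕ] in
theorem numeral_snoc {n : ℕ} (v : Fin k → ℕ) (a : ℕ) :
    (Fin.snoc (fun i => numeral ι (v i)) (numeral ι a) : Fin (k + 1) → L.Term (Empty ⊕ Fin n)) =
      fun i => numeral ι ((Fin.snoc v a : Fin (k + 1) → ℕ) i) := by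
  funext i
  induction i using Fin.lastCases <;> simp

theorem IsRepresentable.of_iff {R S : (Fin k → ℕ) → Prop} (h : IsRepresentable ι T R)
    (H : ∀ v, S v ↔ R v) : IsRepresentable ι T S := by
  rwa [funext fun v => propext (H v)]

theorem IsRepresentable.and {R S : (Fin k → ℕ) → Prop} (hR : IsRepresentable ι T R)
    (hS : IsRepresentable ι T S) : IsRepresentable ι T fun v => R v ∧ S v := by
  obtain ⟨φ, h₁, h₂⟩ := hR
  obtain ⟨ψ, h₃, h₄⟩ := hS
  refine ⟨φ ⊓ ψ, fun v h => ?_, fun v h n Γ => .andI (h₂ v h.1 Γ) (h₄ v h.2 Γ)⟩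
  rw [BoundedFormula.realize_inf] at h
  exact ⟨h₁ v h.1, h₃ v h.2⟩

theorem IsRepresentable.or {R S : (Fin k → ℕ) → Prop} (hR : IsRepresentable ι T R)
    (hS : IsRepresentable ι T S) : IsRepresentable ι T fun v => R v ∨ S v := by
  obtain ⟨φ, h₁, h₂⟩ := hR
  obtain ⟨ψ, h₃, h₄⟩ := hS
  refine ⟨φ ⊔ ψ, fun v h => ?_, fun v h n Γ => ?_⟩
  · rw [BoundedFormula.realize_sup] at h
    exact h.imp (h₁ v) (h₃ v)
  · exact h.elim (fun h => .orI_left (h₂ v h Γ)) fun h => .orI_right (h₄ v h Γ)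

theorem IsRepresentable.ex {R : (Fin k → ℕ) → ℕ → Prop}
    (hR : IsRepresentable ι T fun v : Fin (k + 1) → ℕ => R (Fin.init v) (v (Fin.last k))) :
    IsRepresentable ι T fun v => ∃ a, R v a := by
  obtain ⟨φ, h₁, h₂⟩ := hR
  refine ⟨φ.ex, fun v h => ?_, fun v ⟨a, h⟩ n Γ => ?_⟩
  · rw [BoundedFormula.realize_ex] at h
    obtain ⟨a, ha⟩ := h
    exact ⟨a, by simpa using h₁ _ ha⟩
  · refine Derives.exI (numeral ι a) ?_
    rw [inst_substFormula_liftSubst, numeral_snoc]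
    exact h₂ _ (by simpa using h) Γ

/-- Only functions given by terms are substituted directly; other functions are composed through an
existential quantifier over the intermediate value. -/
theorem IsRepresentable.comp {m : ℕ} {R : (Fin m → ℕ) → Prop} (hR : IsRepresentable ι T R)
    {f : Fin m → (Fin k → ℕ) → ℕ} (hf : ∀ i, IsTermFun ι T (f i)) :
    IsRepresentable ι T fun v => R fun i => f i v := by
  obtain ⟨φ, h₁, h₂⟩ := hR
  choose t h₃ h₄ using hf
  refine ⟨substFormula t φ, fun v h => h₁ _ ?_, fun v h n Γ => ?_⟩
  · rw [realize_substFormula] at h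
    simpa only [h₃] using h
  · rw [substFormula_substFormula]
    exact .eqSubst_forall φ (fun i => .eqSymm (h₄ i v Γ)) (h₂ _ h Γ)

variable [ι.IsExpansionOn ℕ]

theorem IsTermFun.const (a : ℕ) : IsTermFun ι T fun _ : Fin k → ℕ => a :=
  ⟨numeral ι a, fun _ => by simp, fun _ _ _ => by simpa using .eqRefl _⟩

variable (hT : ExtendsRobinson ι T)
include hT

theorem IsTermFun.add (hf : IsTermFun ι T f) (hg : IsTermFun ι T g) :
    IsTermFun ι T fun v => f v + g v := by
  obtain ⟨t, h₁, h₂⟩ := hf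
  obtain ⟨u, h₃, h₄⟩ := hg
  refine ⟨addL ι t u, fun v => by simp [h₁, h₃], fun v n Γ => ?_⟩
  rw [substTerm_addL]
  exact .eqTrans (.add_congr (h₂ v Γ) (h₄ v Γ)) (hT.add_numeral _ _)

theorem IsTermFun.mul (hf : IsTermFun ι T f) (hg : IsTermFun ι T g) :
    IsTermFun ι T fun v => f v * g v := by
  obtain ⟨t, h₁, h₂⟩ := hf
  obtain ⟨u, h₃, h₄⟩ := hg
  refine ⟨mulL ι t u, fun v => by simp [h₁, h₃], fun v n Γ => ?_⟩
  rw [substTerm_mulL]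
  exact .eqTrans (.mul_congr (h₂ v Γ) (h₄ v Γ)) (hT.mul_numeral _ _)

omit [ι.IsExpansionOn ℕ] hT in
theorem IsRepresentable.eq (hf : IsTermFun ι T f) (hg : IsTermFun ι T g) :
    IsRepresentable ι T fun v => f v = g v := by
  obtain ⟨t, h₁, h₂⟩ := hf
  obtain ⟨u, h₃, h₄⟩ := hg
  refine ⟨.equal t u, fun v h => ?_, fun v h n Γ => ?_⟩
  · change f v = g v
    rw [← h₁, ← h₃]
    exact h
  · exact .eqTrans (h₂ v Γ) (.eqSymm (h ▸ h₄ v Γ))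

theorem IsRepresentable.ball {R : (Fin k → ℕ) → ℕ → Prop} (hf : IsTermFun ι T f)
    (hR : IsRepresentable ι T fun v : Fin (k + 1) → ℕ => R (Fin.init v) (v (Fin.last k))) :
    IsRepresentable ι T fun v => ∀ a < f v, R v a := by
  obtain ⟨φ, h₁, h₂⟩ := hR
  obtain ⟨t, h₃, h₄⟩ := hf
  -- The bound x < t is expressed as ∃ z, z + S x = t, the shape that
  -- `ExtendsRobinson.of_add_succ_eq_numeral` analyses; `t` is weakened past both binders.
  refine ⟨.all (.imp (.ex (.equal
    (addL ι (.var (.inr (Fin.last _))) (succL ι (.var (.inr (Fin.last _).castSucc))))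
    (substTerm (wkSubst _) (substTerm (wkSubst _) t)))) φ), fun v h a ha => ?_, fun v h n Γ => ?_⟩
  · rw [BoundedFormula.realize_all] at h
    have := h a
    rw [BoundedFormula.realize_imp, BoundedFormula.realize_ex] at this
    have := h₁ _ (this ⟨f v - (a + 1), ?_⟩)
    · simpa using this
    · simp [BoundedFormula.Realize, realize_substTerm, h₃]
      lia
  · refine .allI (.impI (.exE .head ?_))
    refine hT.of_add_succ_eq_numeral (u := .var (.inr (Fin.last _)))
      (t := .var (.inr (Fin.last _).castSucc)) (f v) ?_ fun i hi => .impI ?_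
    · have key : Derives T (substFormula (liftSubst (liftSubst fun i => numeral ι (v i)))
          (.equal (addL ι (.var (.inr (Fin.last _))) (succL ι (.var (.inr (Fin.last _).castSucc))))
            (substTerm (wkSubst _) (substTerm (wkSubst _) t))) ::
          (substFormula (liftSubst fun i => numeral ι (v i)) (.ex (.equal
            (addL ι (.var (.inr (Fin.last _))) (succL ι (.var (.inr (Fin.last _).castSucc))))
            (substTerm (wkSubst _) (substTerm (wkSubst _) t)))) :: Γ.map weaken).map weaken)
          (.equal (addL ι (.var (.inr (Fin.last (n + 1))))
            (succL ι (.var (.inr (Fin.last n).castSucc))))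
            (substTerm (fun i => numeral ι (v i)) t)) := by
        refine .hyp ?_
        simp [substFormula, substTerm_substTerm]
      exact .eqTrans key (h₄ v _)
    -- In the case x = i, the derivable instance of `φ` at the numeral of i is carried over to x by
    -- equality.
    · rw [weaken, substFormula_substFormula]
      refine .eqSubst_forall φ (fun j => ?_)
        (h₂ (Fin.snoc v i : Fin (k + 1) → ℕ) (by simpa using h i hi) _)
      induction j using Fin.lastCases with
      | last => simpa using .eqSymm .head
      | cast j => simpa using .eqRefl _

end Representable

/-! ### Representability of partial recursive functions -/

/-- A recursion converges to y exactly when it has a history of intermediate values ending in y; the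
history is what the β function will code. -/
theorem mem_natRec_iff {α : Type*} (p : Part α) (g : ℕ → α → Part α) (n : ℕ) (y : α) :
    y ∈ (Nat.rec p (fun i IH => IH.bind (g i)) n : Part α) ↔
      ∃ h : ℕ → α, h 0 ∈ p ∧ (∀ i < n, h (i + 1) ∈ g i (h i)) ∧ h n = y := by
  induction n generalizing y with
  | zero =>
    refine ⟨fun hy => ⟨fun _ => y, hy, by simp, rfl⟩, ?_⟩
    rintro ⟨h, h₀, -, rfl⟩
    exact h₀
  | succ n ih =>
    simp only [Part.mem_bind_iff, ih]
    constructor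
    · rintro ⟨b, ⟨h, h₀, h₁, rfl⟩, hy⟩
      refine ⟨fun i => if i ≤ n then h i else y, by simpa, fun i hi => ?_, by simp⟩
      rcases Nat.lt_succ_iff_lt_or_eq.1 hi with hi | rfl
      · simpa [hi.le, Nat.succ_le_of_lt hi] using h₁ i hi
      · simpa using hy
    · rintro ⟨h, h₀, h₁, rfl⟩
      exact ⟨h n, ⟨h, h₀, fun i hi => h₁ i (by lia), rfl⟩, h₁ n (by lia)⟩

/-- Gödel's β lemma: an existential quantifier over numbers can stand for one over finite sequences.
-/
theorem exists_beta_eq (h : ℕ → ℕ) (n : ℕ) : ∃ s, ∀ i ≤ n, Nat.beta s i = h i := by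
  refine ⟨Nat.unbeta ((List.range (n + 1)).map h), fun i hi => ?_⟩
  have := Nat.beta_unbeta_coe ((List.range (n + 1)).map h) ⟨i, by simp; lia⟩
  simpa using this

section Partrec

variable {L : FirstOrder.Language.{u, v}} {ι : arith →ᴸ L} {T : L.Theory} [L.Structure ℕ] {k : ℕ}

theorem IsRepresentable.comp₂ {R : ℕ → ℕ → Prop}
    (hR : IsRepresentable ι T fun v : Fin 2 → ℕ => R (v 0) (v 1)) {f g : (Fin k → ℕ) → ℕ}
    (hf : IsTermFun ι T f) (hg : IsTermFun ι T g) : IsRepresentable ι T fun v => R (f v) (g v) :=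
  hR.comp (f := ![f, g]) fun i => by fin_cases i <;> assumption

theorem IsRepresentable.comp_graph {f : ℕ →. ℕ}
    (hf : IsRepresentable ι T fun v : Fin 2 → ℕ => v 1 ∈ f (v 0)) {a b : (Fin k → ℕ) → ℕ}
    (ha : IsTermFun ι T a) (hb : IsTermFun ι T b) : IsRepresentable ι T fun v => b v ∈ f (a v) :=
  hf.comp₂ (R := fun x y => y ∈ f x) ha hb

theorem IsRepresentable.comp₃ {R : ℕ → ℕ → ℕ → Prop}
    (hR : IsRepresentable ι T fun v : Fin 3 → ℕ => R (v 0) (v 1) (v 2))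
    {f g h : (Fin k → ℕ) → ℕ} (hf : IsTermFun ι T f) (hg : IsTermFun ι T g)
    (hh : IsTermFun ι T h) : IsRepresentable ι T fun v => R (f v) (g v) (h v) :=
  hR.comp (f := ![f, g, h]) fun i => by fin_cases i <;> assumption

variable [ι.IsExpansionOn ℕ] (hT : ExtendsRobinson ι T)
include hT

theorem IsRepresentable.lt {f g : (Fin k → ℕ) → ℕ} (hf : IsTermFun ι T f) (hg : IsTermFun ι T g) :
    IsRepresentable ι T fun v => f v < g v := by
  refine .comp₂ (R := (· < ·)) ?_ hf hg
  -- Projections are numbered from the outside: arguments first, then each quantifier takes the next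
  -- index, so z is `.proj 2`.
  refine .of_iff (R := fun v => ∃ z, z + (v 0 + 1) = v 1)
    (.ex (.eq (.add hT (.proj 2) (.add hT (.proj 0) (.const 1))) (.proj 1))) fun v => ?_
  exact ⟨fun h => ⟨v 1 - (v 0 + 1), by lia⟩, fun ⟨z, h⟩ => by lia⟩

theorem IsRepresentable.pair {f g h : (Fin k → ℕ) → ℕ} (hf : IsTermFun ι T f) (hg : IsTermFun ι T g)
    (hh : IsTermFun ι T h) : IsRepresentable ι T fun v => Nat.pair (f v) (g v) = h v := by
  refine .comp₃ (R := fun a b c => Nat.pair a b = c) ?_ hf hg hh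
  -- These are the two branches of `Nat.pair`. No closure under negation is available, so the
  -- failure of v 0 < v 1 is written ∃ z, z + v 1 = v 0.
  refine .of_iff (R := fun v => (v 0 < v 1 ∧ v 1 * v 1 + v 0 = v 2) ∨
      ((∃ z, z + v 1 = v 0) ∧ v 0 * v 0 + v 0 + v 1 = v 2))
    (.or (.and (.lt hT (.proj 0) (.proj 1))
      (.eq (.add hT (.mul hT (.proj 1) (.proj 1)) (.proj 0)) (.proj 2)))
    (.and (.ex (.eq (.add hT (.proj 3) (.proj 1)) (.proj 0)))
      (.eq (.add hT (.add hT (.mul hT (.proj 0) (.proj 0)) (.proj 0)) (.proj 1)) (.proj 2))))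
    fun v => ?_
  have : (∃ z, z + v 1 = v 0) ↔ ¬ v 0 < v 1 :=
    ⟨fun ⟨z, h⟩ => by lia, fun h => ⟨v 0 - v 1, by lia⟩⟩
  rw [this, Nat.pair]
  split_ifs with h <;> simp [h]

theorem IsRepresentable.beta {f g h : (Fin k → ℕ) → ℕ} (hf : IsTermFun ι T f) (hg : IsTermFun ι T g)
    (hh : IsTermFun ι T h) : IsRepresentable ι T fun v => Nat.beta (f v) (g v) = h v := by
  refine .comp₃ (R := fun a b c => Nat.beta a b = c) ?_ hf hg hh
  -- `Nat.beta` is a remainder, characterized by a quotient d and the bound by the modulus.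
  refine .of_iff (R := fun v => ∃ p q, Nat.pair p q = v 0 ∧
      (∃ d, p = d * ((v 1 + 1) * q + 1) + v 2) ∧ v 2 < (v 1 + 1) * q + 1) ?_ fun v => ?_
  · refine .ex (.ex (.and (.pair hT (.proj 3) (.proj 4) (.proj 0))
      (.and (.ex (.eq (.proj 3) (.add hT (.mul hT (.proj 5) (.add hT (.mul hT
        (.add hT (.proj 1) (.const 1)) (.proj 4)) (.const 1))) (.proj 2)))) ?_)))
    exact IsRepresentable.lt hT (.proj 2)
      (.add hT (.mul hT (.add hT (.proj 1) (.const 1)) (.proj 4)) (.const 1))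
  · rw [Nat.beta]
    constructor
    · intro h
      refine ⟨(v 0).unpair.1, (v 0).unpair.2, Nat.pair_unpair _,
        ⟨(v 0).unpair.1 / ((v 1 + 1) * (v 0).unpair.2 + 1), ?_⟩, ?_⟩
      · rw [← h, mul_comm, Nat.div_add_mod]
      · rw [← h]
        exact Nat.mod_lt _ (Nat.succ_pos _)
    · rintro ⟨p, q, h, ⟨d, hd⟩, hlt⟩
      rw [← h, Nat.unpair_pair, hd, mul_comm d]
      simpa using Nat.mod_eq_of_lt hlt

/-- Each clause generating the partial recursive functions defines its graph positively, by ∧, ∃ and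
bounded ∀, from graphs already represented. -/
theorem isRepresentable_graph {f : ℕ →. ℕ} (hf : Nat.Partrec f) :
    IsRepresentable ι T fun v : Fin 2 → ℕ => v 1 ∈ f (v 0) := by
  induction hf with
  | zero =>
    exact .of_iff (.eq (.proj 1) (.const 0)) fun v => by simp [pure, PFun.pure, eq_comm]
  | succ =>
    exact .of_iff (.eq (.proj 1) (.add hT (.proj 0) (.const 1))) fun v => by simp
  | left =>
    refine .of_iff (R := fun v => ∃ b, Nat.pair (v 1) b = v 0)
      (.ex (.pair hT (.proj 1) (.proj 2) (.proj 0))) fun v => ?_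
    simp only [PFun.coe_val, Part.mem_some_iff]
    exact ⟨fun h => ⟨(v 0).unpair.2, by rw [h, Nat.pair_unpair]⟩, fun ⟨b, h⟩ => by simp [← h]⟩
  | right =>
    refine .of_iff (R := fun v => ∃ b, Nat.pair b (v 1) = v 0)
      (.ex (.pair hT (.proj 2) (.proj 1) (.proj 0))) fun v => ?_
    simp only [PFun.coe_val, Part.mem_some_iff]
    exact ⟨fun h => ⟨(v 0).unpair.1, by rw [h, Nat.pair_unpair]⟩, fun ⟨b, h⟩ => by simp [← h]⟩
  | @pair f g _ _ ihf ihg =>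
    refine .of_iff (R := fun v => ∃ a b, a ∈ f (v 0) ∧ b ∈ g (v 0) ∧ Nat.pair a b = v 1)
      (.ex (.ex (.and (ihf.comp_graph (.proj 0) (.proj 2)) (.and
        (ihg.comp_graph (.proj 0) (.proj 3))
        (.pair hT (.proj 2) (.proj 3) (.proj 1)))))) fun v => ?_
    simp [Seq.seq]
  | @comp f g _ _ ihf ihg =>
    refine .of_iff (R := fun v => ∃ a, a ∈ g (v 0) ∧ v 1 ∈ f a)
      (.ex (.and (ihg.comp_graph (.proj 0) (.proj 2)) (ihf.comp_graph (.proj 2) (.proj 1))))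
      fun v => ?_
    exact Part.mem_bind_iff
  | @prec f g _ _ ihf ihg =>
    -- The number s codes the history of the recursion. Intermediate values are named by variables
    -- because β and pairing are represented as relations, not as terms.
    refine .of_iff (R := fun v => ∃ a n s, Nat.pair a n = v 0 ∧ (∃ c, Nat.beta s 0 = c ∧ c ∈ f a) ∧
        (∀ i < n, ∃ b c d e, Nat.beta s i = b ∧ Nat.beta s (i + 1) = c ∧ Nat.pair i b = d ∧
          Nat.pair a d = e ∧ c ∈ g e) ∧ Nat.beta s n = v 1) ?_ fun v => ?_
    · refine .ex (.ex (.ex (.and (.pair hT (.proj 2) (.proj 3) (.proj 0)) (.and (.ex (.and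
        (.beta hT (.proj 4) (.const 0) (.proj 5)) (ihf.comp_graph (.proj 2) (.proj 5)))) (.and
        (.ball hT (.proj 3) (.ex (.ex (.ex (.ex (.and (.beta hT (.proj 4) (.proj 5) (.proj 6))
        (.and (.beta hT (.proj 4) (.add hT (.proj 5) (.const 1)) (.proj 7)) (.and
        (.pair hT (.proj 5) (.proj 6) (.proj 8)) (.and (.pair hT (.proj 2) (.proj 8) (.proj 9))
        (ihg.comp_graph (.proj 9) (.proj 7)))))))))))
        (.beta hT (.proj 4) (.proj 3) (.proj 1)))))))
    · have := mem_natRec_iff (f (v 0).unpair.1)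
        (fun y i => g (Nat.pair (v 0).unpair.1 (Nat.pair y i))) (v 0).unpair.2 (v 1)
      refine this.trans ⟨?_, ?_⟩
      · rintro ⟨h, h₀, h₁, h₂⟩
        obtain ⟨s, hs⟩ := exists_beta_eq h (v 0).unpair.2
        refine ⟨_, _, s, Nat.pair_unpair _, ⟨_, hs 0 (Nat.zero_le _), h₀⟩, fun i hi => ?_,
          (hs _ le_rfl).trans h₂⟩
        exact ⟨_, _, _, _, hs i hi.le, hs (i + 1) hi, rfl, rfl, h₁ i hi⟩
      · rintro ⟨a, n, s, h, ⟨c, hc, hcf⟩, h₁, h₂⟩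
        rw [← h, Nat.unpair_pair]
        refine ⟨Nat.beta s, hc ▸ hcf, fun i hi => ?_, h₂⟩
        obtain ⟨_, _, _, _, rfl, rfl, rfl, rfl, h⟩ := h₁ i hi
        exact h
  | @rfind f _ ihf =>
    -- Below the minimum, f must converge to a nonzero value; writing it z + 1 avoids a negation.
    refine .of_iff (R := fun v => (∃ d, Nat.pair (v 0) (v 1) = d ∧ 0 ∈ f d) ∧
      ∀ i < v 1, ∃ d z, Nat.pair (v 0) i = d ∧ z + 1 ∈ f d)
      (.and (.ex (.and (.pair hT (.proj 0) (.proj 1) (.proj 2))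
        (ihf.comp_graph (.proj 2) (.const 0))))
        (.ball hT (.proj 1) (.ex (.ex (.and (.pair hT (.proj 0) (.proj 2) (.proj 3))
          (ihf.comp_graph (.proj 3) (.add hT (.proj 4) (.const 1)))))))) fun v => ?_
    refine Nat.mem_rfind.trans (and_congr ?_ ⟨fun h i hi => ?_, fun h i hi => ?_⟩)
    · simp
    · obtain ⟨z, hz, h0⟩ := (Part.mem_map_iff _).1 (h hi)
      obtain ⟨z, rfl⟩ := Nat.exists_eq_succ_of_ne_zero (of_decide_eq_false h0)
      exact ⟨_, z, rfl, hz⟩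
    · obtain ⟨_, z, rfl, hz⟩ := h i hi
      exact (Part.mem_map_iff _).2 ⟨_, hz, by simp⟩

end Partrec

/-! ### Inductive definitions with recursively enumerable rules -/

section Closure

variable {α β J : Type*} [Primcodable α] [Primcodable β] [Primcodable J]

theorem _root_.REPred.of_exists_primrec {p : α → Prop} {q : α → β → Prop} (hq : PrimrecRel q)
    (h : ∀ a, p a ↔ ∃ b, q a b) : REPred p := by
  classical
  -- Unbounded search runs over codes of witnesses; a number that decodes to nothing counts as a
  -- failure by the default `false`.
  have h₁ : Primrec₂ fun (a : α) (n : ℕ) =>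
      ((Encodable.decode (α := β) n).map fun b => decide (q a b)).getD false :=
    Primrec.option_getD.comp
      (Primrec.option_map (Primrec.decode.comp Primrec.snd)
        (hq.decide.comp (Primrec.fst.comp Primrec.fst) Primrec.snd)) (Primrec.const false)
  refine (Partrec.rfind (h₁.to_comp.partrec₂)).dom_re.of_eq fun a => ?_
  rw [h, Nat.rfind_dom]
  constructor
  · rintro ⟨n, hn, -⟩
    simp only [PFun.coe_val, Part.mem_some_iff] at hn
    cases hd : Encodable.decode (α := β) n with
    | none => simp [hd] at hn
    | some b => exact ⟨b, by simpa [hd] using hn⟩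
  · rintro ⟨b, hb⟩
    exact ⟨Encodable.encode b, by simpa using hb, fun _ => trivial⟩

theorem _root_.REPred.comp_computable {p : β → Prop} (hp : REPred p) {f : α → β}
    (hf : Computable f) : REPred fun a => p (f a) :=
  Partrec.comp hp hf

/-- Kleene's normal form: n bounds the evaluation of a program semi-deciding p, and bounded
evaluation is primitive recursive. -/
theorem _root_.REPred.exists_primrec {p : α → Prop} (hp : REPred p) :
    ∃ q : α → ℕ → Prop, PrimrecRel q ∧ ∀ a, p a ↔ ∃ n, q a n := by
  obtain ⟨c, hc⟩ := Nat.Partrec.Code.exists_code.1 hp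
  refine ⟨fun a n => (Nat.Partrec.Code.evaln n c (Encodable.encode a)).isSome = true, ?_, ?_⟩
  · have h₁ : Primrec fun x : α × ℕ => Nat.Partrec.Code.evaln x.2 c (Encodable.encode x.1) :=
      Nat.Partrec.Code.primrec_evaln.comp ((Primrec.snd.pair (Primrec.const c)).pair
        (Primrec.encode.comp Primrec.fst))
    exact Primrec.eq.comp (Primrec.option_isSome.comp h₁) (Primrec.const true)
  · intro a
    have h₁ : (Nat.Partrec.Code.eval c (Encodable.encode a)).Dom ↔ p a := by
      rw [hc]
      simp [Part.assert, Part.bind]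
    rw [← h₁, Part.dom_iff_mem]
    simp only [Nat.Partrec.Code.evaln_complete, Option.isSome_iff_exists, Option.mem_def]
    exact exists_comm

theorem primrecRel_mem [DecidableEq J] : PrimrecRel fun (x : J) (l : List J) => x ∈ l :=
  ((Primrec.eq (α := J)).exists_mem_list.comp Primrec.snd Primrec.fst).of_eq fun x => by simp

/-- A set is the range of a primitive recursive function restricted to a primitive recursive
set. -/
def IsEnumerable (S : Set J) : Prop :=
  ∃ (f : ℕ → Option J), Primrec f ∧ ∀ x, x ∈ S ↔ ∃ n, f n = some x

theorem IsEnumerable.of_eq {S S' : Set J} (h : IsEnumerable S) (e : S = S') : IsEnumerable S' :=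
  e ▸ h

theorem IsEnumerable.of_primrec {c : α → Prop} (hc : PrimrecPred c) {r : α → J} (hr : Primrec r) :
    IsEnumerable {x | ∃ a, c a ∧ x = r a} := by
  classical
  refine ⟨fun n => (Encodable.decode (α := α) n).bind fun a => if c a then some (r a) else none,
    Primrec.option_bind Primrec.decode (Primrec.ite (hc.comp Primrec.snd)
      (Primrec.option_some.comp (hr.comp Primrec.snd)) (Primrec.const none)), fun x => ?_⟩
  constructor
  · rintro ⟨a, ha, rfl⟩
    exact ⟨Encodable.encode a, by simp [ha]⟩
  · rintro ⟨n, hn⟩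
    obtain ⟨a, -, ha⟩ := Option.bind_eq_some_iff.1 hn
    split_ifs at ha with h
    exact ⟨a, h, (Option.some_inj.1 ha).symm⟩

theorem IsEnumerable.range {r : α → J} (hr : Primrec r) : IsEnumerable {x | ∃ a, x = r a} :=
  (IsEnumerable.of_primrec (c := fun _ => True) ⟨inferInstance, by simpa using Primrec.const true⟩
    hr).of_eq (by simp)

theorem IsEnumerable.union {S S' : Set J} (h : IsEnumerable S) (h' : IsEnumerable S') :
    IsEnumerable (S ∪ S') := by
  obtain ⟨f, hf, hS⟩ := h
  obtain ⟨g, hg, hS'⟩ := h'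
  refine ⟨fun n => (Encodable.decode (α := ℕ ⊕ ℕ) n).bind (Sum.elim f g),
    Primrec.option_bind Primrec.decode
      (Primrec.sumCasesOn Primrec.snd (hf.comp Primrec.snd) (hg.comp Primrec.snd)), fun x => ?_⟩
  rw [Set.mem_union, hS, hS']
  constructor
  · rintro (⟨n, hn⟩ | ⟨n, hn⟩)
    · exact ⟨Encodable.encode (Sum.inl n : ℕ ⊕ ℕ),
        by simpa only [Encodable.encodek, Option.bind_some, Sum.elim_inl, Sum.elim_inr] using hn⟩
    · exact ⟨Encodable.encode (Sum.inr n : ℕ ⊕ ℕ),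
        by simpa only [Encodable.encodek, Option.bind_some, Sum.elim_inl, Sum.elim_inr] using hn⟩
  · rintro ⟨n, hn⟩
    obtain ⟨a | a, -, ha⟩ := Option.bind_eq_some_iff.1 hn
    exacts [.inl ⟨a, ha⟩, .inr ⟨a, ha⟩]

theorem IsEnumerable.biUnion {l : List (Set J)} (h : ∀ S ∈ l, IsEnumerable S) :
    IsEnumerable {x | ∃ S ∈ l, x ∈ S} := by
  induction l with
  | nil => exact ⟨fun _ => none, Primrec.const _, by simp⟩
  | cons S l ih =>
    rw [List.forall_mem_cons] at h
    refine (h.1.union (ih h.2)).of_eq ?_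
    ext x
    simp

/-- The least set closed under the given rules. A rule is a set of pairs consisting of a list of
premises and a conclusion. -/
inductive RuleClosure {J : Type*} (rules : List (Set (List J × J))) : J → Prop
  | intro {S : Set (List J × J)} {ps : List J} {c : J} : S ∈ rules → (ps, c) ∈ S →
      (∀ p ∈ ps, RuleClosure rules p) → RuleClosure rules c

/-- Adds the conclusion of a rule to a list which contains its premises. -/
def ruleStep {J : Type*} [DecidableEq J] (r : Option (List J × J)) (l : List J) : List J :=
  r.elim l fun x => if ∀ p ∈ x.1, p ∈ l then x.2 :: l else l

/-- A derivation is a list of indices of rule instances, executed from the right; an instance whose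
premises are not yet present has no effect. Checking that such a run produces a given element is
primitive recursive, so an unbounded search semi-decides the closure. -/
theorem RuleClosure.rePred {rules : List (Set (List J × J))}
    (h : ∀ S ∈ rules, IsEnumerable S) : REPred (RuleClosure rules) := by
  classical
  obtain ⟨f, hf, hS⟩ := IsEnumerable.biUnion h
  let run : List ℕ → List J := fun ws => ws.foldr (fun w l => ruleStep (f w) l) []
  have run_cons (w : ℕ) (ws : List ℕ) : run (w :: ws) = ruleStep (f w) (run ws) := rfl
  have hstep : Primrec fun x : Option (List J × J) × List J => ruleStep x.1 x.2 := by
    have h₁ : Primrec₂ fun (x : Option (List J × J) × List J) (y : List J × J) =>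
        if ∀ p ∈ y.1, p ∈ x.2 then y.2 :: x.2 else x.2 := by
      refine Primrec.ite ?_ ?_ ?_
      · exact (primrecRel_mem (J := J)).forall_mem_list.comp (Primrec.fst.comp Primrec.snd)
          (Primrec.snd.comp Primrec.fst)
      · exact Primrec.list_cons.comp (Primrec.snd.comp Primrec.snd) (Primrec.snd.comp Primrec.fst)
      · exact Primrec.snd.comp Primrec.fst
    refine (Primrec.option_casesOn Primrec.fst Primrec.snd h₁).of_eq fun x => ?_
    rcases x with ⟨_ | _, _⟩ <;> rfl
  have hrun : Primrec run :=
    Primrec.list_foldr (h := fun _ x => ruleStep (f x.1) x.2) Primrec.id (Primrec.const [])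
      (hstep.comp ((hf.comp (Primrec.fst.comp Primrec.snd)).pair (Primrec.snd.comp Primrec.snd)))
  refine .of_exists_primrec (q := fun c ws => c ∈ run ws)
    (primrecRel_mem.comp Primrec.fst (hrun.comp Primrec.snd)) fun c => ⟨fun hc => ?_, ?_⟩
  · have mono (ws ws' : List ℕ) : ∀ x ∈ run ws', x ∈ run (ws ++ ws') := by
      induction ws with
      | nil => exact fun _ => id
      | cons w ws ih =>
        intro x hx
        rw [List.cons_append, run_cons, ruleStep]
        cases f w with
        | none => exact ih x hx
        | some y =>
          dsimp only [Option.elim]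
          split_ifs
          exacts [List.mem_cons_of_mem _ (ih x hx), ih x hx]
    -- Allowing an arbitrary earlier run `ws` lets the derivations of the several premises be
    -- concatenated.
    suffices H : ∀ ws, ∃ ws', c ∈ run (ws' ++ ws) by
      obtain ⟨ws, hws⟩ := H []
      exact ⟨_, hws⟩
    induction hc with
    | @intro S ps c hmem hps hclosed ih =>
      intro ws
      have H : ∃ ws', ∀ p ∈ ps, p ∈ run (ws' ++ ws) := by
        clear hps hclosed
        induction ps with
        | nil => exact ⟨[], by simp⟩
        | cons p ps ihps =>
          obtain ⟨ws₁, h₁⟩ := ihps fun q hq => ih q (List.mem_cons_of_mem _ hq)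
          obtain ⟨ws₂, h₂⟩ := ih p List.mem_cons_self (ws₁ ++ ws)
          refine ⟨ws₂ ++ ws₁, fun q hq => ?_⟩
          rw [List.append_assoc]
          rcases List.mem_cons.1 hq with rfl | hq
          exacts [h₂, mono _ _ _ (h₁ q hq)]
      obtain ⟨ws', h'⟩ := H
      obtain ⟨w, hw⟩ := (hS (ps, c)).1 ⟨S, hmem, hps⟩
      refine ⟨w :: ws', ?_⟩
      rw [List.cons_append, run_cons, hw, ruleStep]
      simp [if_pos h']
  · rintro ⟨ws, hws⟩
    induction ws generalizing c with
    | nil => simp [run] at hws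
    | cons w ws ih =>
      rw [run_cons, ruleStep] at hws
      cases hw : f w with
      | none => exact ih c (by simpa [hw] using hws)
      | some y =>
        rw [hw] at hws
        dsimp only [Option.elim] at hws
        split_ifs at hws with hy
        · rcases List.mem_cons.1 hws with rfl | hws
          · obtain ⟨S, hS₁, hS₂⟩ := (hS y).2 ⟨w, hw⟩
            exact .intro hS₁ hS₂ fun p hp => ih p (hy p hp)
          · exact ih c hws
        · exact ih c hws

end Closure

/-! ### Codes of terms and formulas -/

section Codes

variable {L : FirstOrder.Language.{u, v}} (num : L.Symbols → ℕ)

/-- The number of the variable `i`. -/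
def varCode (i : ℕ) : ℕ := treeCode 0 [i]
/-- The number of the formula `⊥`. -/
def botCode : ℕ := treeCode 0 []
/-- The number of an equation. -/
def eqCode (t u : ℕ) : ℕ := treeCode 1 [t, u]
/-- The number of an implication. -/
def impCode (p q : ℕ) : ℕ := treeCode 2 [p, q]
/-- The number of a universal quantification. -/
def allCode (p : ℕ) : ℕ := treeCode 3 [p]
/-- The numbers of the first `n` variables. -/
def varCodes (n : ℕ) : List ℕ := (List.range n).map varCode

theorem treeCode_inj {a b : ℕ} {l l' : List ℕ} : treeCode a l = treeCode b l' ↔ a = b ∧ l = l' := by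
  rw [treeCode, treeCode, Encodable.encode_inj, List.cons.injEq]

variable {num}

/-- Label 0 is kept for variables by the shift of `num`, and a symbol carries its arity, so the root
label determines the shape. Codes do not record the context, so it is fixed here. -/
theorem termCode_injective (hnum : Function.Injective num) {n : ℕ} :
    Function.Injective (termCode num : L.Term (Empty ⊕ Fin n) → ℕ) := by
  intro t
  induction t with
  | var i =>
    rcases i with i | i
    · exact i.elim
    intro u h
    rcases u with ⟨j | j⟩ | ⟨g, us⟩
    · exact j.elim
    · simp only [termCode, treeCode_inj, List.cons.injEq, Fin.val_inj] at h
      rw [h.2.1]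
    · simp [termCode, treeCode_inj] at h
  | @func k f ts ih =>
    intro u h
    rcases u with ⟨j | j⟩ | ⟨g, us⟩
    · exact j.elim
    · simp [termCode, treeCode_inj] at h
    · rw [termCode, termCode, treeCode_inj] at h
      have h₁ := hnum (Nat.succ_injective h.1)
      obtain ⟨rfl, h₁⟩ := Sigma.mk.inj_iff.1 (Sum.inl_injective h₁)
      obtain rfl := eq_of_heq h₁
      rw [funext fun i => ih i (congrFun (List.ofFn_injective h.2) i)]

theorem formulaCode_injective (hnum : Function.Injective num) {n : ℕ} :
    Function.Injective (formulaCode num : L.BoundedFormula Empty n → ℕ) := by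
  intro φ
  induction φ with
  | falsum =>
    intro ψ h
    cases ψ <;> simp [formulaCode, treeCode_inj] at h ⊢
  | equal t u =>
    intro ψ h
    cases ψ <;> simp [formulaCode, treeCode_inj, (termCode_injective hnum).eq_iff] at h ⊢
    exact h
  | @rel n l R ts =>
    intro ψ h
    cases ψ with
    | rel R' us =>
      rw [formulaCode, formulaCode, treeCode_inj] at h
      have h₁ := hnum (Nat.add_right_cancel h.1)
      obtain ⟨rfl, h₁⟩ := Sigma.mk.inj_iff.1 (Sum.inr_injective h₁)
      obtain rfl := eq_of_heq h₁
      rw [funext fun i => termCode_injective hnum (congrFun (List.ofFn_injective h.2) i)]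
    | _ => simp [formulaCode, treeCode_inj] at h
  | imp φ ψ h₁ h₂ =>
    intro χ h
    cases χ <;> simp [formulaCode, treeCode_inj] at h ⊢
    exact ⟨h₁ h.1, h₂ h.2⟩
  | all φ ih =>
    intro ψ h
    cases ψ <;> simp [formulaCode, treeCode_inj] at h ⊢
    exact ih h

theorem formulaCode_eq_impCode {n p q : ℕ} {φ : L.BoundedFormula Empty n}
    (h : formulaCode num φ = impCode p q) :
    ∃ ψ χ, φ = .imp ψ χ ∧ formulaCode num ψ = p ∧ formulaCode num χ = q := by
  cases φ <;> simp [formulaCode, impCode, treeCode_inj] at h ⊢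
  exact h

theorem formulaCode_eq_allCode {n p : ℕ} {φ : L.BoundedFormula Empty n}
    (h : formulaCode num φ = allCode p) : ∃ ψ, φ = .all ψ ∧ formulaCode num ψ = p := by
  cases φ <;> simp [formulaCode, allCode, treeCode_inj] at h ⊢
  exact h

theorem formulaCode_eq_eqCode {n p q : ℕ} {φ : L.BoundedFormula Empty n}
    (h : formulaCode num φ = eqCode p q) :
    ∃ t u, φ = .equal t u ∧ termCode num t = p ∧ termCode num u = q := by
  cases φ <;> simp [formulaCode, eqCode, treeCode_inj] at h ⊢
  exact h

variable (num)

/-- The number of a term after substitution of terms with given numbers for its variables. -/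
def termSubstCode (σ : List ℕ) {m : ℕ} : L.Term (Empty ⊕ Fin m) → ℕ
  | .var (.inr i) => σ.getD i 0
  | .func f ts =>
      treeCode (num (.inl ⟨_, f⟩) + 1) (List.ofFn fun i => termSubstCode σ (ts i))

/-- The number of a formula after substitution of terms with given numbers, in context `n`, for
its free variables. -/
def formulaSubstCode : List ℕ → ℕ → ∀ {m : ℕ}, L.BoundedFormula Empty m → ℕ
  | _, _, _, .falsum => botCode
  | σ, _, _, .equal t u => eqCode (termSubstCode num σ t) (termSubstCode num σ u)
  | σ, n, _, .imp φ ψ => impCode (formulaSubstCode σ n φ) (formulaSubstCode σ n ψ)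
  | σ, n, _, .all φ => allCode (formulaSubstCode (σ ++ [varCode n]) (n + 1) φ)
  | σ, _, _, .rel R ts =>
      treeCode (num (.inr ⟨_, R⟩) + 4) (List.ofFn fun i => termSubstCode num σ (ts i))

/-- The numbers of the terms of a substitution. -/
def substCodes {m n : ℕ} (σ : Fin m → L.Term (Empty ⊕ Fin n)) : List ℕ :=
  List.ofFn fun i => termCode num (σ i)

@[simp]
theorem length_substCodes {m n : ℕ} (σ : Fin m → L.Term (Empty ⊕ Fin n)) :
    (substCodes num σ).length = m := by
  simp [substCodes]

theorem termSubstCode_substCodes {m n : ℕ} (σ : Fin m → L.Term (Empty ⊕ Fin n))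
    (t : L.Term (Empty ⊕ Fin m)) :
    termSubstCode num (substCodes num σ) t = termCode num (substTerm σ t) := by
  induction t with
  | var i =>
    rcases i with i | i
    · exact i.elim
    · simp [termSubstCode, substCodes]
  | func f ts ih => simp [termSubstCode, termCode, ih]

/-- Variables are numbered from the outermost binder inwards, so weakening leaves codes unchanged,
and passing under a quantifier only appends the new variable to a coded substitution. -/
theorem termCode_substTerm_wkSubst {n : ℕ} (t : L.Term (Empty ⊕ Fin n)) :
    termCode num (substTerm (wkSubst n) t) = termCode num t := by
  induction t with
  | var i =>
    rcases i with i | i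
    · exact i.elim
    · simp [termCode]
  | func f ts ih => simp [termCode, ih]

theorem substCodes_snoc {m n : ℕ} (σ : Fin m → L.Term (Empty ⊕ Fin n))
    (t : L.Term (Empty ⊕ Fin n)) :
    substCodes num (Fin.snoc σ t : Fin (m + 1) → L.Term (Empty ⊕ Fin n)) =
      substCodes num σ ++ [termCode num t] := by
  rw [substCodes, List.ofFn_succ']
  simp [substCodes]

theorem substCodes_liftSubst {m n : ℕ} (σ : Fin m → L.Term (Empty ⊕ Fin n)) :
    substCodes num (liftSubst σ) = substCodes num σ ++ [varCode n] := by
  rw [substCodes, List.ofFn_succ']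
  simp [substCodes, termCode_substTerm_wkSubst, termCode, varCode]

theorem substCodes_idSubst (n : ℕ) :
    substCodes num (idSubst n : Fin n → L.Term _) = varCodes n := by
  exact List.ext_getElem (by simp [varCodes]) (by simp [substCodes, varCodes, varCode, termCode])

/-- Weakening and identity share a code list; in a formula judgment only the target context tells
them apart. -/
theorem substCodes_wkSubst (n : ℕ) :
    substCodes num (wkSubst n : Fin n → L.Term _) = varCodes n := by
  rw [← substCodes_idSubst num]
  rfl

theorem formulaSubstCode_substCodes {m n : ℕ} (σ : Fin m → L.Term (Empty ⊕ Fin n))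
    (φ : L.BoundedFormula Empty m) :
    formulaSubstCode num (substCodes num σ) n φ = formulaCode num (substFormula σ φ) := by
  induction φ generalizing n with
  | falsum => rfl
  | equal t u =>
    simp [formulaSubstCode, substFormula, formulaCode, termSubstCode_substCodes, eqCode]
  | rel R ts => simp [formulaSubstCode, substFormula, formulaCode, termSubstCode_substCodes]
  | imp φ ψ h₁ h₂ => simp [formulaSubstCode, substFormula, formulaCode, h₁, h₂, impCode]
  | all φ h =>
    simp [formulaSubstCode, substFormula, formulaCode, ← h, substCodes_liftSubst, allCode]

end Codes

/-! ### Rules for deriving codes -/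

section Rules

/-- A judgment on codes: a tag and its arguments. -/
abbrev Judgment := ℕ × List ℕ × ℕ × ℕ × ℕ

/-- `t` is the number of a term that becomes `t'` under the substitution `σ`. -/
def termJ (σ : List ℕ) (t t' : ℕ) : Judgment := (0, σ, 0, t, t')
/-- `p` is the number of a formula that becomes `p'` under the substitution `σ` of terms in
context `n`. -/
def formulaJ (σ : List ℕ) (n p p' : ℕ) : Judgment := (1, σ, n, p, p')
/-- The formula with number `p` is derivable from the ones with numbers in `Γ`, in context `n`. -/
def derivesJ (n : ℕ) (Γ : List ℕ) (p : ℕ) : Judgment := (2, Γ, n, p, 0)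
/-- The elements of `Γ` are numbers of formulas in context `n`. -/
def formulasJ (n : ℕ) (Γ : List ℕ) : List Judgment := Γ.map fun p => formulaJ (varCodes n) n p p

/-- A rule on judgments. -/
abbrev JudgmentRule := Set (List Judgment × Judgment)

def varRule : JudgmentRule :=
  {x | ∃ (σ : List ℕ) (i : ℕ), i < σ.length ∧ x = ([], termJ σ (varCode i) (σ.getD i 0))}

/-- `fs` lists the labels and the arities of the function symbols. -/
def funcRule (fs : List (ℕ × ℕ)) : JudgmentRule :=
  {x | ∃ (f : ℕ × ℕ) (σ : List ℕ) (ts : List (ℕ × ℕ)), (f ∈ fs ∧ ts.length = f.2) ∧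
    x = (ts.map fun y => termJ σ y.1 y.2,
      termJ σ (treeCode f.1 (ts.map Prod.fst)) (treeCode f.1 (ts.map Prod.snd)))}

def botRule : JudgmentRule :=
  {x | ∃ (σ : List ℕ) (n : ℕ), x = ([], formulaJ σ n botCode botCode)}

def eqRule : JudgmentRule :=
  {x | ∃ (σ : List ℕ) (n t t' u u' : ℕ), x = ([termJ σ t t', termJ σ u u'],
    formulaJ σ n (eqCode t u) (eqCode t' u'))}

def impRule : JudgmentRule :=
  {x | ∃ (σ : List ℕ) (n p p' q q' : ℕ), x = ([formulaJ σ n p p', formulaJ σ n q q'],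
    formulaJ σ n (impCode p q) (impCode p' q'))}

def allRule : JudgmentRule :=
  {x | ∃ (σ : List ℕ) (n p p' : ℕ), x = ([formulaJ (σ ++ [varCode n]) (n + 1) p p'],
    formulaJ σ n (allCode p) (allCode p'))}

/-- `rs` lists the labels and the arities of the relation symbols. -/
def relRule (rs : List (ℕ × ℕ)) : JudgmentRule :=
  {x | ∃ (r : ℕ × ℕ) (σ : List ℕ) (n : ℕ) (ts : List (ℕ × ℕ)), (r ∈ rs ∧ ts.length = r.2) ∧
    x = (ts.map fun y => termJ σ y.1 y.2,
      formulaJ σ n (treeCode r.1 (ts.map Prod.fst)) (treeCode r.1 (ts.map Prod.snd)))}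

/-- `∃ s, q p s` says that `p` is the number of an axiom. -/
def axRule (q : ℕ → ℕ → Prop) : JudgmentRule :=
  {x | ∃ (n : ℕ) (Γ : List ℕ) (p p' s : ℕ), q p s ∧
    x = (formulaJ [] n p p' :: formulasJ n Γ, derivesJ n Γ p')}

/-- The premises ensure that every number in Γ codes a formula in context n, as the meaning of the
conclusion requires. -/
def hypRule : JudgmentRule :=
  {x | ∃ (n : ℕ) (Γ : List ℕ) (p : ℕ), p ∈ Γ ∧ x = (formulasJ n Γ, derivesJ n Γ p)}

def impIRule : JudgmentRule :=
  {x | ∃ (n : ℕ) (Γ : List ℕ) (p q : ℕ),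
    x = ([derivesJ n (p :: Γ) q], derivesJ n Γ (impCode p q))}

def impERule : JudgmentRule :=
  {x | ∃ (n : ℕ) (Γ : List ℕ) (p q : ℕ),
    x = ([derivesJ n Γ (impCode p q), derivesJ n Γ p], derivesJ n Γ q)}

def raaRule : JudgmentRule :=
  {x | ∃ (n : ℕ) (Γ : List ℕ) (p : ℕ),
    x = ([derivesJ n (impCode p botCode :: Γ) botCode], derivesJ n Γ p)}

/-- Γ pairs each hypothesis with its weakening; the premises verify this by the substitution
`varCodes n` into context n + 1. -/
def allIRule : JudgmentRule :=
  {x | ∃ (n : ℕ) (Γ : List (ℕ × ℕ)) (p : ℕ),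
    x = (derivesJ (n + 1) (Γ.map Prod.snd) p ::
      Γ.map fun y => formulaJ (varCodes n) (n + 1) y.1 y.2,
      derivesJ n (Γ.map Prod.fst) (allCode p))}

/-- That t codes a term in context n is expressed by its being fixed by the identity substitution.
-/
def allERule : JudgmentRule :=
  {x | ∃ (n : ℕ) (Γ : List ℕ) (p t p' : ℕ),
    x = ([derivesJ n Γ (allCode p), termJ (varCodes n) t t,
      formulaJ (varCodes n ++ [t]) n p p'], derivesJ n Γ p')}

def eqReflRule : JudgmentRule :=
  {x | ∃ (n : ℕ) (Γ : List ℕ) (t : ℕ),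
    x = (termJ (varCodes n) t t :: formulasJ n Γ, derivesJ n Γ (eqCode t t))}

def eqSubstRule : JudgmentRule :=
  {x | ∃ (n : ℕ) (Γ : List ℕ) (t u p q q' : ℕ),
    x = ([derivesJ n Γ (eqCode t u), formulaJ (varCodes n ++ [t]) n p q,
      formulaJ (varCodes n ++ [u]) n p q', derivesJ n Γ q], derivesJ n Γ q')}

/-- The rules for judgments in a language with given symbols and a theory with given axioms. -/
def judgmentRules (fs rs : List (ℕ × ℕ)) (q : ℕ → ℕ → Prop) : List JudgmentRule :=
  [varRule, funcRule fs, botRule, eqRule, impRule, allRule, relRule rs, axRule q, hypRule, impIRule,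
    impERule, raaRule, allIRule, allERule, eqReflRule, eqSubstRule]

/-! ### Enumerability of each judgment rule -/

section Enumerable

variable {α β γ : Type*} [Primcodable α] [Primcodable β] [Primcodable γ]

attribute [local fun_prop] Primrec Primrec.id Primrec.const Primrec.comp Primrec.encode

@[local fun_prop]
theorem primrec_fst {f : α → β × γ} (hf : Primrec f) : Primrec fun a => (f a).1 :=
  Primrec.fst.comp hf

@[local fun_prop]
theorem primrec_snd {f : α → β × γ} (hf : Primrec f) : Primrec fun a => (f a).2 :=
  Primrec.snd.comp hf

@[local fun_prop]
theorem primrec_pair {f : α → β} {g : α → γ} (hf : Primrec f) (hg : Primrec g) :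
    Primrec fun a => (f a, g a) :=
  Primrec.pair hf hg

@[local fun_prop]
theorem primrec_cons {f : α → β} {g : α → List β} (hf : Primrec f) (hg : Primrec g) :
    Primrec fun a => f a :: g a :=
  Primrec.list_cons.comp hf hg

@[local fun_prop]
theorem primrec_append {f : α → List β} {g : α → List β} (hf : Primrec f) (hg : Primrec g) :
    Primrec fun a => f a ++ g a :=
  Primrec.list_append.comp hf hg

@[local fun_prop]
theorem primrec_succ {f : α → ℕ} (hf : Primrec f) : Primrec fun a => f a + 1 :=
  Primrec.succ.comp hf

@[local fun_prop]
theorem primrec_map {f : α → List β} {g : α → β → γ} (hf : Primrec f)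
    (hg : Primrec fun x : α × β => g x.1 x.2) : Primrec fun a => (f a).map (g a) :=
  Primrec.list_map hf hg

@[local fun_prop]
theorem primrec_getD {f : α → List ℕ} {g : α → ℕ} (hf : Primrec f) (hg : Primrec g) :
    Primrec fun a => (f a).getD (g a) 0 :=
  (Primrec.list_getD 0).comp hf hg

@[local fun_prop]
theorem primrec_length {f : α → List β} (hf : Primrec f) : Primrec fun a => (f a).length :=
  Primrec.list_length.comp hf

@[local fun_prop]
theorem primrec_range {f : α → ℕ} (hf : Primrec f) : Primrec fun a => List.range (f a) :=
  Primrec.list_range.comp hf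

@[local fun_prop]
theorem primrec_varCodes {f : α → ℕ} (hf : Primrec f) : Primrec fun a => varCodes (f a) := by
  simp only [varCodes]
  refine primrec_map (by fun_prop) ?_
  simp only [varCode, treeCode]
  fun_prop

/-- Each rule is the primitive recursive image of its parameters, gathered into one tuple. Side
conditions occur only for variables, symbols, axioms and hypotheses, and all are primitive
recursive. -/
theorem isEnumerable_of_forall_mem {fs rs : List (ℕ × ℕ)} {q : ℕ → ℕ → Prop} (hq : PrimrecRel q) :
    ∀ S ∈ judgmentRules fs rs q, IsEnumerable S := by
  simp only [judgmentRules, List.forall_mem_cons, varRule, funcRule, botRule, eqRule, impRule,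
    allRule, relRule, axRule, hypRule, impIRule, impERule, raaRule, allIRule, allERule, eqReflRule,
    eqSubstRule, termJ, formulaJ, derivesJ, formulasJ, varCode, botCode, eqCode, impCode,
    allCode, treeCode, ← Prod.exists']
  refine ⟨.of_primrec ?_ ?_, .of_primrec ?_ ?_, .range ?_, .range ?_, .range ?_, .range ?_,
    .of_primrec ?_ ?_, .of_primrec ?_ ?_, .of_primrec ?_ ?_, .range ?_, .range ?_, .range ?_,
    .range ?_, .range ?_, .range ?_, .range ?_, by simp⟩
  case refine_1 => exact Primrec.nat_lt.comp (by fun_prop) (by fun_prop)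
  case refine_3 =>
    refine PrimrecPred.and (primrecRel_mem.comp ?_ ?_) (Primrec.eq.comp ?_ ?_) <;> fun_prop
  case refine_9 =>
    refine PrimrecPred.and (primrecRel_mem.comp ?_ ?_) (Primrec.eq.comp ?_ ?_) <;> fun_prop
  case refine_11 => exact hq.comp (by fun_prop) (by fun_prop)
  case refine_13 => exact primrecRel_mem.comp (by fun_prop) (by fun_prop)
  all_goals fun_prop

end Enumerable

end Rules

/-! ### Provability is recursively enumerable -/

/-! ### Soundness of the judgment rules -/

section Soundness

variable {L : FirstOrder.Language.{u, v}} (num : L.Symbols → ℕ) (T : L.Theory)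

/-- The meaning of the judgments. -/
def Judgment.Valid : Judgment → Prop
  | (0, σ, _, t, t') => ∃ (m : ℕ) (τ : L.Term (Empty ⊕ Fin m)), σ.length = m ∧
      termCode num τ = t ∧ termSubstCode num σ τ = t'
  | (1, σ, n, p, p') => ∃ (m : ℕ) (φ : L.BoundedFormula Empty m), σ.length = m ∧
      formulaCode num φ = p ∧ formulaSubstCode num σ n φ = p'
  | (2, Γ, n, p, _) => ∃ (Δ : List (L.BoundedFormula Empty n)) (φ : L.BoundedFormula Empty n),
      Δ.map (formulaCode num) = Γ ∧ formulaCode num φ = p ∧ Derives T Δ φ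
  | _ => False

/-- A rule all of whose instances preserve validity. -/
def JudgmentRule.Sound (S : JudgmentRule) : Prop :=
  ∀ x ∈ S, (∀ p ∈ x.1, Judgment.Valid num T p) → Judgment.Valid num T x.2

variable {num T}

@[simp]
theorem length_varCodes (n : ℕ) : (varCodes n).length = n := by simp [varCodes]

theorem Judgment.Valid.term {n t t' : ℕ} (h : Judgment.Valid num T (termJ (varCodes n) t t')) :
    ∃ τ : L.Term (Empty ⊕ Fin n), termCode num τ = t := by
  obtain ⟨m, τ, hm, h, -⟩ := h
  obtain rfl : n = m := by simpa using hm
  exact ⟨τ, h⟩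

theorem Judgment.Valid.formula {n n' p p' : ℕ}
    (h : Judgment.Valid num T (formulaJ (varCodes n) n' p p')) :
    ∃ φ : L.BoundedFormula Empty n, formulaCode num φ = p ∧
      formulaSubstCode num (varCodes n) n' φ = p' := by
  obtain ⟨m, τ, hm, h⟩ := h
  obtain rfl : n = m := by simpa using hm
  exact ⟨τ, h⟩

theorem Judgment.Valid.inst {n p p' : ℕ} {t : L.Term (Empty ⊕ Fin n)}
    (h : Judgment.Valid num T (formulaJ (varCodes n ++ [termCode num t]) n p p')) :
    ∃ φ : L.BoundedFormula Empty (n + 1), formulaCode num φ = p ∧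
      formulaCode num (inst φ t) = p' := by
  obtain ⟨m, φ, hm, h, h'⟩ := h
  obtain rfl : n + 1 = m := by simpa using hm
  refine ⟨φ, h, ?_⟩
  rw [Incompleteness.inst, ← h', ← formulaSubstCode_substCodes, substCodes_snoc, substCodes_idSubst]

theorem exists_formulas_of_valid {n : ℕ} {Γ : List ℕ}
    (h : ∀ x ∈ formulasJ n Γ, Judgment.Valid num T x) :
    ∃ Δ : List (L.BoundedFormula Empty n), Δ.map (formulaCode num) = Γ := by
  induction Γ with
  | nil => exact ⟨[], rfl⟩
  | cons p Γ ih =>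
    obtain ⟨Δ, hΔ⟩ := ih fun x hx => h x (List.mem_cons_of_mem _ hx)
    obtain ⟨φ, hφ, -⟩ := (h _ List.mem_cons_self).formula
    exact ⟨φ :: Δ, by simp [hφ, hΔ]⟩

theorem sound_varRule : JudgmentRule.Sound num T varRule := by
  rintro _ ⟨σ, i, hi, rfl⟩ -
  exact ⟨σ.length, .var (.inr ⟨i, hi⟩), rfl, rfl, rfl⟩

theorem exists_terms_of_valid {k : ℕ} {σ : List ℕ} {ts : List (ℕ × ℕ)} (hk : ts.length = k)
    (h : ∀ x ∈ ts.map fun y => termJ σ y.1 y.2, Judgment.Valid num T x) :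
    ∃ τ : Fin k → L.Term (Empty ⊕ Fin σ.length),
      (List.ofFn fun i => termCode num (τ i)) = ts.map Prod.fst ∧
      (List.ofFn fun i => termSubstCode num σ (τ i)) = ts.map Prod.snd := by
  subst hk
  have h' (i : Fin ts.length) : ∃ τ : L.Term (Empty ⊕ Fin σ.length),
      termCode num τ = ts[i].1 ∧ termSubstCode num σ τ = ts[i].2 := by
    obtain ⟨m, τ, rfl, h⟩ := h _ (List.mem_map_of_mem (List.getElem_mem i.2))
    exact ⟨τ, h⟩
  choose τ h₁ h₂ using h'
  exact ⟨τ, List.ext_getElem (by simp) (by simp [h₁]), List.ext_getElem (by simp) (by simp [h₂])⟩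

theorem sound_funcRule {fs : List (ℕ × ℕ)}
    (hfs : ∀ x ∈ fs, ∃ (k : ℕ) (f : L.Functions k), x = (num (.inl ⟨k, f⟩) + 1, k)) :
    JudgmentRule.Sound num T (funcRule fs) := by
  rintro _ ⟨x, σ, ts, ⟨hx, hk⟩, rfl⟩ h
  obtain ⟨k, f, rfl⟩ := hfs x hx
  obtain ⟨τ, h₁, h₂⟩ := exists_terms_of_valid hk h
  exact ⟨_, .func f τ, rfl, by simp [termCode, h₁], by simp [termSubstCode, h₂]⟩

theorem sound_botRule : JudgmentRule.Sound num T botRule := by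
  rintro _ ⟨σ, n, rfl⟩ -
  exact ⟨_, .falsum, rfl, rfl, rfl⟩

theorem sound_eqRule : JudgmentRule.Sound num T eqRule := by
  rintro _ ⟨σ, n, _, _, _, _, rfl⟩ h
  obtain ⟨_, τ, rfl, rfl, rfl⟩ := h _ List.mem_cons_self
  obtain ⟨_, υ, rfl, rfl, rfl⟩ := h _ (List.mem_cons_of_mem _ List.mem_cons_self)
  exact ⟨_, .equal τ υ, rfl, rfl, rfl⟩

theorem sound_impRule : JudgmentRule.Sound num T impRule := by
  rintro _ ⟨σ, n, _, _, _, _, rfl⟩ h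
  obtain ⟨_, φ, rfl, rfl, rfl⟩ := h _ List.mem_cons_self
  obtain ⟨_, ψ, rfl, rfl, rfl⟩ := h _ (List.mem_cons_of_mem _ List.mem_cons_self)
  exact ⟨_, .imp φ ψ, rfl, rfl, rfl⟩

theorem sound_allRule : JudgmentRule.Sound num T allRule := by
  rintro _ ⟨σ, n, _, _, rfl⟩ h
  obtain ⟨m, φ, hm, rfl, rfl⟩ := h _ List.mem_cons_self
  obtain rfl : σ.length + 1 = m := by simpa using hm
  exact ⟨_, .all φ, rfl, rfl, rfl⟩

theorem sound_relRule {rs : List (ℕ × ℕ)}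
    (hrs : ∀ x ∈ rs, ∃ (k : ℕ) (f : L.Relations k), x = (num (.inr ⟨k, f⟩) + 4, k)) :
    JudgmentRule.Sound num T (relRule rs) := by
  rintro _ ⟨x, σ, n, ts, ⟨hx, hk⟩, rfl⟩ h
  obtain ⟨k, R, rfl⟩ := hrs x hx
  obtain ⟨τ, h₁, h₂⟩ := exists_terms_of_valid hk h
  exact ⟨_, .rel R τ, rfl, by simp [formulaCode, h₁], by simp [formulaSubstCode, h₂]⟩

variable (hnum : Function.Injective num)
include hnum

/-- The empty substitution list forces the empty context, so the coded formula is a sentence, and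
injectivity identifies it with an axiom. -/
theorem sound_axRule {q : ℕ → ℕ → Prop}
    (hq : ∀ p s, q p s → ∃ φ ∈ T, formulaCode num φ = p) :
    JudgmentRule.Sound num T (axRule q) := by
  rintro _ ⟨n, Γ, p, p', s, hs, rfl⟩ h
  rw [List.forall_mem_cons] at h
  obtain ⟨⟨m, φ, hm, rfl, rfl⟩, h⟩ := h
  obtain rfl : 0 = m := hm
  obtain ⟨Δ, rfl⟩ := exists_formulas_of_valid h
  obtain ⟨ψ, hψ, e⟩ := hq _ s hs
  obtain rfl := formulaCode_injective hnum e
  refine ⟨Δ, sentenceIn n ψ, rfl, ?_, .ax hψ⟩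
  rw [sentenceIn, ← formulaSubstCode_substCodes]
  simp [substCodes]

omit hnum in
theorem sound_hypRule : JudgmentRule.Sound num T hypRule := by
  rintro _ ⟨n, Γ, p, hp, rfl⟩ h
  obtain ⟨Δ, rfl⟩ := exists_formulas_of_valid h
  obtain ⟨φ, hφ, rfl⟩ := List.mem_map.1 hp
  exact ⟨Δ, φ, rfl, rfl, .hyp hφ⟩

omit hnum in
theorem sound_impIRule : JudgmentRule.Sound num T impIRule := by
  rintro _ ⟨n, Γ, p, _, rfl⟩ h
  obtain ⟨Δ, φ, hΔ, rfl, hφ⟩ := h _ List.mem_cons_self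
  obtain ⟨ψ, Δ, rfl, rfl, rfl⟩ := List.map_eq_cons_iff.1 hΔ
  exact ⟨Δ, .imp ψ φ, rfl, rfl, .impI hφ⟩

/-- The two premises produce formulas separately; injectivity of codes shows that those sharing a
code agree. -/
theorem sound_impERule : JudgmentRule.Sound num T impERule := by
  rintro _ ⟨n, _, p, q, rfl⟩ h
  obtain ⟨Δ, φ, rfl, hφ, h₁⟩ := h _ List.mem_cons_self
  obtain ⟨ψ, χ, rfl, rfl, rfl⟩ := formulaCode_eq_impCode hφ
  obtain ⟨Δ', ψ', hΔ, hψ, h₂⟩ := h _ (List.mem_cons_of_mem _ List.mem_cons_self)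
  obtain rfl := (formulaCode_injective hnum).list_map hΔ
  obtain rfl := formulaCode_injective hnum hψ
  exact ⟨_, χ, rfl, rfl, .impE h₁ h₂⟩

theorem sound_raaRule : JudgmentRule.Sound num T raaRule := by
  rintro _ ⟨n, Γ, p, rfl⟩ h
  obtain ⟨Δ, φ, hΔ, hφ, h₁⟩ := h _ List.mem_cons_self
  obtain ⟨ψ, Δ, rfl, hψ, rfl⟩ := List.map_eq_cons_iff.1 hΔ
  obtain ⟨χ, β, rfl, rfl, hβ⟩ := formulaCode_eq_impCode hψ
  obtain rfl : φ = .falsum := formulaCode_injective hnum hφ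
  obtain rfl : β = .falsum := formulaCode_injective hnum hβ
  exact ⟨Δ, χ, rfl, rfl, .raa h₁⟩

theorem sound_allIRule : JudgmentRule.Sound num T allIRule := by
  rintro _ ⟨n, Γ, p, rfl⟩ h
  rw [List.forall_mem_cons] at h
  obtain ⟨⟨Δ, φ, hΔ, rfl, h₁⟩, h⟩ := h
  have : ∃ Δ' : List (L.BoundedFormula Empty n), Δ'.map (formulaCode num) = Γ.map Prod.fst ∧
      (Δ'.map weaken).map (formulaCode num) = Γ.map Prod.snd := by
    clear hΔ
    induction Γ with
    | nil => exact ⟨[], rfl, rfl⟩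
    | cons y Γ ih =>
      obtain ⟨Δ', h₁, h₂⟩ := ih fun x hx => h x (List.mem_cons_of_mem _ hx)
      obtain ⟨ψ, hψ, hψ'⟩ := (h _ List.mem_cons_self).formula
      refine ⟨ψ :: Δ', by simp [h₁, hψ], ?_⟩
      rw [List.map_cons, List.map_cons, h₂, List.map_cons, ← hψ', weaken,
        ← formulaSubstCode_substCodes, substCodes_wkSubst]
  obtain ⟨Δ', h₂, h₃⟩ := this
  obtain rfl := (formulaCode_injective hnum).list_map (hΔ.trans h₃.symm)
  exact ⟨Δ', .all φ, h₂, rfl, .allI h₁⟩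

theorem sound_allERule : JudgmentRule.Sound num T allERule := by
  rintro _ ⟨n, _, p, t, p', rfl⟩ h
  simp only [List.forall_mem_cons] at h
  obtain ⟨⟨Δ, φ, rfl, hφ, h₁⟩, h₂, h₃, -⟩ := h
  obtain ⟨ψ, rfl, rfl⟩ := formulaCode_eq_allCode hφ
  obtain ⟨t, rfl⟩ := h₂.term
  obtain ⟨χ, hχ, rfl⟩ := h₃.inst
  obtain rfl := formulaCode_injective hnum hχ
  exact ⟨Δ, _, rfl, rfl, .allE t h₁⟩

omit hnum in
theorem sound_eqReflRule : JudgmentRule.Sound num T eqReflRule := by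
  rintro _ ⟨n, Γ, t, rfl⟩ h
  rw [List.forall_mem_cons] at h
  obtain ⟨t, rfl⟩ := h.1.term
  obtain ⟨Δ, rfl⟩ := exists_formulas_of_valid h.2
  exact ⟨Δ, _, rfl, rfl, .eqRefl t⟩

theorem sound_eqSubstRule : JudgmentRule.Sound num T eqSubstRule := by
  rintro _ ⟨n, _, t, u, p, q, q', rfl⟩ h
  simp only [List.forall_mem_cons] at h
  obtain ⟨⟨Δ, φ, rfl, hφ, h₁⟩, h₂, h₃, ⟨Δ', ψ', hΔ, hψ, h₄⟩, -⟩ := h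
  obtain ⟨t, u, rfl, rfl, rfl⟩ := formulaCode_eq_eqCode hφ
  obtain ⟨ψ, rfl, rfl⟩ := h₂.inst
  obtain ⟨χ, hχ, rfl⟩ := h₃.inst
  obtain rfl := formulaCode_injective hnum hχ
  obtain rfl := (formulaCode_injective hnum).list_map hΔ
  obtain rfl := formulaCode_injective hnum hψ
  exact ⟨_, _, rfl, rfl, .eqSubst _ h₁ h₄⟩

end Soundness

/-! ### Completeness of the judgment rules -/

section Completeness

variable {L : FirstOrder.Language.{u, v}} {num : L.Symbols → ℕ} {T : L.Theory}
  {fs rs : List (ℕ × ℕ)} {q : ℕ → ℕ → Prop}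

theorem closure_termJ (hfs : ∀ (k : ℕ) (f : L.Functions k), (num (.inl ⟨k, f⟩) + 1, k) ∈ fs)
    {σ : List ℕ} {m : ℕ} (hσ : σ.length = m) (t : L.Term (Empty ⊕ Fin m)) :
    RuleClosure (judgmentRules fs rs q) (termJ σ (termCode num t) (termSubstCode num σ t)) := by
  induction t with
  | var i =>
    rcases i with i | i
    · exact i.elim
    · exact .intro (S := varRule) (by simp [judgmentRules]) ⟨σ, i, hσ ▸ i.2, rfl⟩ (by simp)
  | @func k f ts ih =>
    refine .intro (S := funcRule fs) (by simp [judgmentRules]) ⟨(num (.inl ⟨k, f⟩) + 1, k), σ,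
      List.ofFn fun i => (termCode num (ts i), termSubstCode num σ (ts i)),
      ⟨hfs k f, by simp⟩, Prod.ext rfl ?_⟩ ?_
    · simp [List.map_ofFn, Function.comp_def, termCode, termSubstCode]
    · simpa [List.map_ofFn, List.forall_mem_ofFn_iff] using ih

theorem closure_formulaJ (hfs : ∀ (k : ℕ) (f : L.Functions k), (num (.inl ⟨k, f⟩) + 1, k) ∈ fs)
    (hrs : ∀ (k : ℕ) (R : L.Relations k), (num (.inr ⟨k, R⟩) + 4, k) ∈ rs)
    {σ : List ℕ} {m : ℕ} (hσ : σ.length = m) (n : ℕ) (φ : L.BoundedFormula Empty m) :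
    RuleClosure (judgmentRules fs rs q)
      (formulaJ σ n (formulaCode num φ) (formulaSubstCode num σ n φ)) := by
  induction φ generalizing σ n with
  | falsum => exact .intro (S := botRule) (by simp [judgmentRules]) ⟨σ, n, rfl⟩ (by simp)
  | equal t u =>
    refine .intro (S := eqRule) (by simp [judgmentRules]) ⟨σ, n, _, _, _, _, rfl⟩ ?_
    simpa using ⟨closure_termJ hfs hσ t, closure_termJ hfs hσ u⟩
  | @rel _ k R ts =>
    refine .intro (S := relRule rs) (by simp [judgmentRules]) ⟨(num (.inr ⟨k, R⟩) + 4, k), σ, n,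
      List.ofFn fun i => (termCode num (ts i), termSubstCode num σ (ts i)),
      ⟨hrs k R, by simp⟩, Prod.ext rfl ?_⟩ ?_
    · simp [List.map_ofFn, Function.comp_def, formulaCode, formulaSubstCode]
    · simpa [List.map_ofFn, List.forall_mem_ofFn_iff] using fun i => closure_termJ hfs hσ (ts i)
  | imp φ ψ h₁ h₂ =>
    refine .intro (S := impRule) (by simp [judgmentRules]) ⟨σ, n, _, _, _, _, rfl⟩ ?_
    simpa using ⟨h₁ hσ n, h₂ hσ n⟩
  | all φ h =>
    refine .intro (S := allRule) (by simp [judgmentRules]) ⟨σ, n, _, _, rfl⟩ ?_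
    simpa using h (σ := σ ++ [varCode n]) (by simpa using hσ) (n + 1)

/-- Every rule of the calculus has its counterpart on codes. The extra syntactic premises follow
from `closure_formulaJ` and `closure_termJ`, at the identity, weakening, instantiation and empty
substitutions. -/
theorem closure_derivesJ (hfs : ∀ (k : ℕ) (f : L.Functions k), (num (.inl ⟨k, f⟩) + 1, k) ∈ fs)
    (hrs : ∀ (k : ℕ) (R : L.Relations k), (num (.inr ⟨k, R⟩) + 4, k) ∈ rs)
    (hq : ∀ φ ∈ T, ∃ s, q (formulaCode num φ) s) {n : ℕ} {Γ : List (L.BoundedFormula Empty n)}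
    {φ : L.BoundedFormula Empty n} (h : Derives T Γ φ) :
    RuleClosure (judgmentRules fs rs q)
      (derivesJ n (Γ.map (formulaCode num)) (formulaCode num φ)) := by
  have hF {m n : ℕ} (σ : Fin m → L.Term (Empty ⊕ Fin n)) (φ : L.BoundedFormula Empty m) :
      RuleClosure (judgmentRules fs rs q)
        (formulaJ (substCodes num σ) n (formulaCode num φ)
          (formulaCode num (substFormula σ φ))) := by
    rw [← formulaSubstCode_substCodes]
    exact closure_formulaJ hfs hrs (by simp) n φ
  have hΓ {n : ℕ} (Γ : List (L.BoundedFormula Empty n)) :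
      ∀ x ∈ formulasJ n (Γ.map (formulaCode num)), RuleClosure (judgmentRules fs rs q) x := by
    simp only [formulasJ, List.map_map, List.forall_mem_map]
    intro φ _
    have := hF (idSubst n) φ
    rwa [substFormula_idSubst, substCodes_idSubst] at this
  have hI {n : ℕ} (φ : L.BoundedFormula Empty (n + 1)) (t : L.Term (Empty ⊕ Fin n)) :
      RuleClosure (judgmentRules fs rs q) (formulaJ (varCodes n ++ [termCode num t]) n
        (formulaCode num φ) (formulaCode num (inst φ t))) := by
    have := hF (Fin.snoc (idSubst n) t : Fin (n + 1) → L.Term (Empty ⊕ Fin n)) φ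
    rwa [substCodes_snoc, substCodes_idSubst] at this
  have ht {n : ℕ} (t : L.Term (Empty ⊕ Fin n)) : RuleClosure (judgmentRules fs rs q)
      (termJ (varCodes n) (termCode num t) (termCode num t)) := by
    have := closure_termJ (rs := rs) (q := q) hfs (σ := substCodes num (idSubst n)) (by simp) t
    rwa [termSubstCode_substCodes, substTerm_idSubst, substCodes_idSubst] at this
  induction h with
  | @ax n Γ φ hφ =>
    obtain ⟨s, hs⟩ := hq φ hφ
    refine .intro (S := axRule q) (by simp [judgmentRules])
      ⟨n, _, formulaCode num φ, _, s, hs, rfl⟩ ?_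
    simp only [List.forall_mem_cons]
    refine ⟨?_, hΓ Γ⟩
    have := hF (n := n) (fun i => i.elim0) φ
    simpa [substCodes, sentenceIn] using this
  | @hyp n Γ φ hφ =>
    exact .intro (S := hypRule) (by simp [judgmentRules])
      ⟨n, _, _, List.mem_map_of_mem hφ, rfl⟩ (hΓ Γ)
  | impI _ ih =>
    refine .intro (S := impIRule) (by simp [judgmentRules]) ⟨_, _, _, _, rfl⟩ ?_
    simpa using ih
  | @impE _ _ φ _ _ _ ih₁ ih₂ =>
    refine .intro (S := impERule) (by simp [judgmentRules])
      ⟨_, _, formulaCode num φ, _, rfl⟩ ?_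
    simp only [List.forall_mem_cons]
    exact ⟨ih₁, ih₂, by simp⟩
  | raa _ ih =>
    refine .intro (S := raaRule) (by simp [judgmentRules]) ⟨_, _, _, rfl⟩ ?_
    simp only [List.forall_mem_cons]
    exact ⟨ih, by simp⟩
  | @allI n Γ φ _ ih =>
    refine .intro (S := allIRule) (by simp [judgmentRules])
      ⟨n, Γ.map fun γ => (formulaCode num γ, formulaCode num (weaken γ)), formulaCode num φ,
        Prod.ext rfl ?_⟩ ?_
    · simp [Function.comp_def, formulaCode, allCode]
    · simp only [List.forall_mem_cons, List.forall_mem_map]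
      refine ⟨by simpa [Function.comp_def] using ih, fun γ _ => ?_⟩
      have := hF (wkSubst n) γ
      rwa [substCodes_wkSubst] at this
  | @allE _ _ φ t _ ih =>
    refine .intro (S := allERule) (by simp [judgmentRules])
      ⟨_, _, formulaCode num φ, termCode num t, _, rfl⟩ ?_
    simp only [List.forall_mem_cons]
    exact ⟨ih, ht t, hI _ t, by simp⟩
  | @eqRefl n Γ t =>
    refine .intro (S := eqReflRule) (by simp [judgmentRules]) ⟨_, _, _, rfl⟩ ?_
    simp only [List.forall_mem_cons]
    exact ⟨ht t, hΓ Γ⟩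
  | @eqSubst _ _ φ t u _ _ ih₁ ih₂ =>
    refine .intro (S := eqSubstRule) (by simp [judgmentRules])
      ⟨_, _, termCode num t, termCode num u, formulaCode num φ,
        formulaCode num (inst φ t), _, rfl⟩ ?_
    simp only [List.forall_mem_cons]
    exact ⟨ih₁, hI φ _, hI φ _, ih₂, by simp⟩

end Completeness

/-- Finiteness of the language makes the symbol tables `fs` and `rs` finite lists; provability is
then the closure under the rules, restricted to judgments with empty context and no hypotheses. -/
theorem rePred_provable {L : FirstOrder.Language.{u, v}} [Finite L.Symbols] {num : L.Symbols → ℕ}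
    (hnum : Function.Injective num) {T : L.Theory}
    (hT : REPred fun k => ∃ φ ∈ T, formulaCode num φ = k) :
    REPred fun k => ∃ φ : L.Sentence, Provable T φ ∧ formulaCode num φ = k := by
  classical
  have : Fintype L.Symbols := Fintype.ofFinite _
  obtain ⟨q, hq, hqT⟩ := hT.exists_primrec
  let fs : List (ℕ × ℕ) := (Finset.univ : Finset L.Symbols).toList.filterMap fun s =>
    match s with
    | .inl ⟨k, f⟩ => some (num (.inl ⟨k, f⟩) + 1, k)
    | .inr _ => none
  let rs : List (ℕ × ℕ) := (Finset.univ : Finset L.Symbols).toList.filterMap fun s =>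
    match s with
    | .inl _ => none
    | .inr ⟨k, R⟩ => some (num (.inr ⟨k, R⟩) + 4, k)
  have hfs (k : ℕ) (f : L.Functions k) : (num (.inl ⟨k, f⟩) + 1, k) ∈ fs :=
    List.mem_filterMap.2 ⟨.inl ⟨k, f⟩, by simp, rfl⟩
  have hrs (k : ℕ) (R : L.Relations k) : (num (.inr ⟨k, R⟩) + 4, k) ∈ rs :=
    List.mem_filterMap.2 ⟨.inr ⟨k, R⟩, by simp, rfl⟩
  have hfs' : ∀ x ∈ fs, ∃ (k : ℕ) (f : L.Functions k), x = (num (.inl ⟨k, f⟩) + 1, k) := by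
    intro x hx
    obtain ⟨⟨k, f⟩ | s, -, hs⟩ := List.mem_filterMap.1 hx
    · exact ⟨k, f, (Option.some_inj.1 hs).symm⟩
    · cases hs
  have hrs' : ∀ x ∈ rs, ∃ (k : ℕ) (R : L.Relations k), x = (num (.inr ⟨k, R⟩) + 4, k) := by
    intro x hx
    obtain ⟨s | ⟨k, R⟩, -, hs⟩ := List.mem_filterMap.1 hx
    · cases hs
    · exact ⟨k, R, (Option.some_inj.1 hs).symm⟩
  have hsound : ∀ S ∈ judgmentRules fs rs q, JudgmentRule.Sound num T S := by
    simp only [judgmentRules, List.forall_mem_cons]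
    exact ⟨sound_varRule, sound_funcRule hfs', sound_botRule, sound_eqRule, sound_impRule,
      sound_allRule, sound_relRule hrs', sound_axRule hnum fun p s h => (hqT p).2 ⟨s, h⟩,
      sound_hypRule, sound_impIRule, sound_impERule hnum, sound_raaRule hnum,
      sound_allIRule hnum, sound_allERule hnum, sound_eqReflRule, sound_eqSubstRule hnum,
      by simp⟩
  have hvalid (x : Judgment) (hx : RuleClosure (judgmentRules fs rs q) x) :
      Judgment.Valid num T x := by
    induction hx with
    | intro hS hx _ ih => exact hsound _ hS _ hx ih
  have hre := RuleClosure.rePred (isEnumerable_of_forall_mem (fs := fs) (rs := rs) hq)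
  have hJ : Computable fun k => derivesJ 0 [] k :=
    ((Primrec.const 2).pair ((Primrec.const []).pair ((Primrec.const 0).pair
      (Primrec.id.pair (Primrec.const 0))))).to_comp
  refine (hre.comp_computable hJ).of_eq fun k => ⟨fun h => ?_, ?_⟩
  · obtain ⟨Δ, φ, hΔ, hφ, h⟩ := hvalid _ h
    obtain rfl := List.map_eq_nil_iff.1 hΔ
    exact ⟨φ, h, hφ⟩
  · rintro ⟨φ, hφ, rfl⟩
    exact closure_derivesJ hfs hrs (fun ψ hψ => (hqT _).1 ⟨ψ, hψ, rfl⟩) hφ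

/-! ### The halting problem and incompleteness -/

open Nat.Partrec (Code) in
/-- The numbers of the programs that halt on input `0`. -/
def haltingSet : Set ℕ := {k | (Code.eval (Denumerable.ofNat Code k) 0).Dom}

theorem not_computablePred_haltingSet : ¬ ComputablePred fun k => k ∈ haltingSet := by
  intro h
  refine ComputablePred.halting_problem 0 ?_
  obtain ⟨f, hf, hfk⟩ := ComputablePred.computable_iff.1 h
  refine ComputablePred.computable_iff.2 ⟨_, hf.comp Computable.encode, funext fun c => ?_⟩
  rw [← congrFun hfk (Encodable.encode c)]
  simp [haltingSet]

/-! ### Reduction of the halting set to provability -/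

section

variable {L : FirstOrder.Language.{u, v}} {ι : arith →ᴸ L} {T : L.Theory}

theorem isRepresentable_haltingSet [L.Structure ℕ] [ι.IsExpansionOn ℕ]
    (hT : ExtendsRobinson ι T) : IsRepresentable ι T fun v : Fin 1 → ℕ => v 0 ∈ haltingSet := by
  let f (k : ℕ) : Part ℕ := Nat.Partrec.Code.eval (Denumerable.ofNat _ k) 0
  have hf : Nat.Partrec f :=
    Partrec.nat_iff.1 (Nat.Partrec.Code.eval_part.comp (Computable.ofNat _) (Computable.const 0))
  exact .of_iff (R := fun v => ∃ a, a ∈ f (v 0))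
    (.ex ((isRepresentable_graph hT hf).comp_graph (.proj 0) (.proj 1)))
    fun v => Part.dom_iff_mem

variable (ι) in
/-- The sentence `∀ x, x = k → φ(x)`. -/
def evalSentence (φ : L.BoundedFormula Empty 1) (k : ℕ) : L.Sentence :=
  .all (.imp (.equal (.var (.inr 0)) (numeral ι k)) φ)

variable (ι) in
theorem primrec_termCode_numeral (num : L.Symbols → ℕ) (n : ℕ) :
    Primrec fun k => termCode num (numeral ι k : L.Term (Empty ⊕ Fin n)) := by
  let g (_ c : ℕ) : ℕ := treeCode (num (.inl ⟨1, ι.onFunction ArithFunc.succ⟩) + 1) [c]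
  have hg : Primrec₂ g := Primrec.encode.comp (Primrec.list_cons.comp (Primrec.const _)
    (Primrec.list_cons.comp Primrec.snd (Primrec.const [])))
  refine (Primrec.nat_rec₁ (termCode num (numeral ι 0 : L.Term (Empty ⊕ Fin n))) hg).of_eq
    fun k => ?_
  induction k with
  | zero => rfl
  | succ k ih =>
    refine (congrArg (g k) ih).trans ?_
    simp [g, numeral, succL, termCode]

variable (ι) in
-- The number k enters only through its numeral in the equation, so no substitution into `φ` has to
-- be computed on codes.
theorem primrec_formulaCode_evalSentence (num : L.Symbols → ℕ) (φ : L.BoundedFormula Empty 1) :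
    Primrec fun k => formulaCode num (evalSentence ι φ k) := by
  have h := primrec_termCode_numeral ι num 1
  have tree {a : ℕ} {f : ℕ → List ℕ} (hf : Primrec f) : Primrec fun k => treeCode a (f k) :=
    Primrec.encode.comp (Primrec.list_cons.comp (Primrec.const a) hf)
  have cons {f : ℕ → ℕ} {g : ℕ → List ℕ} (hf : Primrec f) (hg : Primrec g) :
      Primrec fun k => f k :: g k := Primrec.list_cons.comp hf hg
  exact tree (cons (tree (cons (tree (cons (Primrec.const _) (cons h (Primrec.const _))))
    (Primrec.const _))) (Primrec.const _))

theorem exists_provable_evalSentence_iff [L.Structure ℕ] [ι.IsExpansionOn ℕ]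
    (hT : ExtendsRobinson ι T) (hM : ℕ ⊨ T) :
    ∃ φ : L.BoundedFormula Empty 1, ∀ k, Provable T (evalSentence ι φ k) ↔ k ∈ haltingSet := by
  obtain ⟨φ, h₁, h₂⟩ := isRepresentable_haltingSet hT
  refine ⟨φ, fun k => ⟨fun h => ?_, fun h => ?_⟩⟩
  · have := h.sound hM Empty.elim Fin.elim0 (by simp) k
    exact h₁ _ (this (by simp [BoundedFormula.Realize]; rfl))
  · refine .allI (.impI ?_)
    -- Seen as an identity substitution instance, `φ` follows from its instance at the numeral by
    -- the hypothesis x = k.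
    rw [← substFormula_idSubst φ]
    refine .eqSubst_forall φ (fun i => ?_) (h₂ (fun _ => k) h _)
    · rw [Subsingleton.elim i 0]
      exact .eqSymm .head

theorem exists_formulaCode_iff {num : L.Symbols → ℕ} (hnum : Function.Injective num)
    (ψ : L.Sentence) : (∃ χ : L.Sentence, Provable T χ ∧ formulaCode num χ = formulaCode num ψ) ↔
      Provable T ψ :=
  ⟨fun ⟨_, h, e⟩ => formulaCode_injective hnum e ▸ h, fun h => ⟨ψ, h, rfl⟩⟩

theorem not_decidableSentences_provable {num : L.Symbols → ℕ} (hnum : Function.Injective num)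
    (hT : ExtendsRobinson ι T) (hstd : HasStandardModel ι T) :
    ¬ DecidableSentences num {φ | Provable T φ} := by
  obtain ⟨_, hι, hM⟩ := hstd
  obtain ⟨φ, hφ⟩ := exists_provable_evalSentence_iff hT hM
  intro h
  obtain ⟨f, hf, hfk⟩ := ComputablePred.computable_iff.1 h
  refine not_computablePred_haltingSet (ComputablePred.computable_iff.2
    ⟨_, hf.comp (primrec_formulaCode_evalSentence ι num φ).to_comp, funext fun k => ?_⟩)
  rw [← congrFun hfk, ← hφ]
  exact propext (exists_formulaCode_iff hnum _).symm

/-- Completeness would make non-halting semi-decidable, by searching for a proof of the negated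
sentence; Post's theorem then contradicts the undecidability of halting. -/
theorem not_complete [Finite L.Symbols] {num : L.Symbols → ℕ} (hnum : Function.Injective num)
    (hdec : DecidableSentences num T) (hT : ExtendsRobinson ι T) (hstd : HasStandardModel ι T) :
    ¬ Complete T := by
  obtain ⟨_, hι, hM⟩ := hstd
  obtain ⟨φ, hφ⟩ := exists_provable_evalSentence_iff hT hM
  intro hcomplete
  have hre := rePred_provable hnum hdec.to_re
  have hcode := primrec_formulaCode_evalSentence ι num φ
  have hnot : Primrec fun k => formulaCode num (evalSentence ι φ k).not :=
    Primrec.encode.comp (Primrec.list_cons.comp (Primrec.const 2)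
      (Primrec.list_cons.comp hcode (Primrec.const [botCode])))
  refine not_computablePred_haltingSet (ComputablePred.computable_iff_re_compl_re'.2
    ⟨(hre.comp_computable hcode.to_comp).of_eq fun k =>
      (exists_formulaCode_iff hnum _).trans (hφ k),
    (hre.comp_computable hnot.to_comp).of_eq fun k =>
      (exists_formulaCode_iff hnum _).trans ⟨fun h hk => ?_, fun h => ?_⟩⟩)
  -- The sentence and its negation cannot both hold in the standard model.
  · exact h.sound hM Empty.elim Fin.elim0 (by simp)
      (((hφ k).2 hk).sound hM Empty.elim Fin.elim0 (by simp))
  · exact (hcomplete (evalSentence ι φ k)).resolve_left fun h' => h ((hφ k).1 h')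

end

end Incompleteness

theorem mainTheorem1 {L : FirstOrder.Language.{u, v}} [Finite L.Symbols]
    (num : L.Symbols → ℕ) (hnum : Function.Injective num)
    (ι : Incompleteness.arith →ᴸ L) (T : L.Theory)
    (hdec : Incompleteness.DecidableSentences num T)
    (hrob : Incompleteness.ExtendsRobinson ι T)
    (hstd : Incompleteness.HasStandardModel ι T) :
    ¬ Incompleteness.DecidableSentences num {φ | Incompleteness.Provable T φ} ∧
      ¬ Incompleteness.Complete T :=
  ⟨Incompleteness.not_decidableSentences_provable hnum hrob hstd,
    Incompleteness.not_complete hnum hdec hrob hstd⟩
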